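/- A skew brace $(B,+,\ast)$ is a set $B$ with two group structures $(B,+)$ (not necessarily abelian) and $(B,\ast)$ such that $a\ast(b+c)=(a\ast b)+(-a)+(a\ast c)$ for all $a,b,c\in B$; an isomorphism of skew braces is a bijection that is an isomorphism of both the additive and the multiplicative groups. For finite groups $M$, $A$ of the same order, let $b(M,A)$ be the number of isomorphism classes of skew braces $(B,+,\ast)$ with $(B,\ast)\cong M$ and $(B,+)\cong A$. Let $n\ge 1$ be squarefree, and let $M$ and $A$ be groups of order $n$. Then $A$ is isomorphic to a group $$G(d,e,k)=\langle \sigma,\tau : \sigma^e=\tau^d=1,\ \tau\sigma\tau^{-1}=\sigma^k\rangle$$ with $d,e\ge 1$, $n=de$, $\gcd(d,e)=1$, $k\in\mathbb{Z}$, $\gcd(k,e)=1$ and $k$ of order $d$ in $(\mathbb{Z}/e\mathbb{Z})^\times$. For any such $d,e,k$ with $A\cong G(d,e,k)$, put $z=\gcd(k-1,e)$ and $g=e/z$. Write $\omega(r)$ for the number of distinct prime factors of $r$. Then: (i) If $M$ is cyclic, then $b(M,A)=2^{\omega(g)}$. (ii) If $A$ is cyclic, then $b(M,A)=1$. (iii)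 If $M$ is dihedral of order $n=2m$ with $m$ odd and squarefree, then $b(M,A)=2^{\omega(g)}$ if $d=1$ or $d=2$, and $b(M,A)=0$ if $d>2$. (iv) If $A$ is dihedral of order $n=2m$ with $m$ odd and squarefree, then $b(M,A)=2^{\omega(m)}$. -/

import Mathlib

universe u

/-- A skew (left) brace: two group structures `(B, +)` (not necessarily commutative) and `(B, *)`
on the same set, with `a * (b + c) = a * b + (-a) + a * c`. -/
class SkewBrace (B : Type u) extends AddGroup B, Group B where
  mul_add_eq : ∀ a b c : B, a * (b + c) = a * b + -a + a * c

/-- A skew brace whose multiplicative group is isomorphic to `M` and whose additive group is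
isomorphic to `A` (the group `A` is written multiplicatively, hence `Multiplicative carrier`). -/
structure SkewBraceOn (M A : Type u) [Group M] [Group A] where
  carrier : Type u
  [inst : SkewBrace carrier]
  mul_iso : Nonempty (carrier ≃* M)
  add_iso : Nonempty (Multiplicative carrier ≃* A)

attribute [instance] SkewBraceOn.inst

/-- Isomorphism of skew braces: a bijection that respects both operations. -/
def SkewBraceOn.Iso {M A : Type u} [Group M] [Group A] (X Y : SkewBraceOn M A) : Prop :=
  ∃ f : X.carrier ≃ Y.carrier,
    (∀ a b, f (a + b) = f a + f b) ∧ (∀ a b, f (a * b) = f a * f b)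

/-- Isomorphism is an equivalence relation. -/
instance SkewBraceOn.setoid (M A : Type u) [Group M] [Group A] : Setoid (SkewBraceOn M A) where
  r := SkewBraceOn.Iso
  iseqv :=
    { refl := fun _ => ⟨Equiv.refl _, fun _ _ => rfl, fun _ _ => rfl⟩
      symm := by
        rintro X Y ⟨f, h1, h2⟩
        refine ⟨f.symm, fun a b => f.injective ?_, fun a b => f.injective ?_⟩
        · rw [h1]; simp only [Equiv.apply_symm_apply]
        · rw [h2]; simp only [Equiv.apply_symm_apply]
      trans := by
        rintro X Y Z ⟨f, h1, h2⟩ ⟨f', h1', h2'⟩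
        refine ⟨f.trans f', fun a b => ?_, fun a b => ?_⟩
        · simp only [Equiv.trans_apply, h1, h1']
        · simp only [Equiv.trans_apply, h2, h2'] }

/-- `b(M, A)`: the number of isomorphism classes of skew braces with multiplicative group
isomorphic to `M` and additive group isomorphic to `A`. It takes values in `ℕ∞`, so that equality
with a natural number includes finiteness. -/
noncomputable def numSkewBraces (M A : Type u) [Group M] [Group A] : ℕ∞ :=
  ENat.card (Quotient (SkewBraceOn.setoid M A))

/-- The relators `σ ^ e`, `τ ^ d`, `τ σ τ⁻¹ (σ ^ k)⁻¹`, where `σ`, `τ` are the generators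
`0`, `1`. -/
def metacyclicRels (d e : ℕ) (k : ℤ) : Set (FreeGroup (Fin 2)) :=
  {FreeGroup.of 0 ^ e, FreeGroup.of 1 ^ d,
    FreeGroup.of 1 * FreeGroup.of 0 * (FreeGroup.of 1)⁻¹ * (FreeGroup.of 0 ^ k)⁻¹}

/-- `G(d, e, k) = ⟨σ, τ : σ ^ e = τ ^ d = 1, τ σ τ⁻¹ = σ ^ k⟩`. -/
abbrev MetacyclicGroup (d e : ℕ) (k : ℤ) : Type := PresentedGroup (metacyclicRels d e k)

/-- `A = G(d, e, k)` (up to isomorphism) is a group of order `n = d e`, with `gcd(d, e) = 1`,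
`gcd(k, e) = 1`, and `k` of order `d` modulo `e`. -/
structure HasParameters (A : Type u) [Group A] (n d e : ℕ) (k : ℤ) : Prop where
  card_eq : n = d * e
  coprime : Nat.Coprime d e
  unit : Int.gcd k e = 1
  order_eq : orderOf (k : ZMod e) = d
  iso : Nonempty (A ≃* MetacyclicGroup d e k)

/-- The parameter `z = gcd(k - 1, e)`. -/
def paramZ (e : ℕ) (k : ℤ) : ℕ := Int.gcd (k - 1) e

/-- The parameter `g = e / z`; the division is exact. -/
def paramG (e : ℕ) (k : ℤ) : ℕ := e / paramZ e k

/-! For each prime p dividing n, a group of squarefree order n has a cocycle x_p with values in ℤ/p,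
for a character χ_p, that does not vanish on ker χ_p. Since p² ∤ n, χ_p is unique
(`IsCocycle.char_eq`) and x_p is unique up to scaling and coboundaries (`IsCocycle.eq_affine`).
Together the x_p are a bijection onto ∏ ℤ/p, and automorphisms are affine changes of coordinates,
with no freedom at the primes of `D` (those dividing d in G(d, e, k)).

A skew brace is a bijection π : M → A whose lambda maps are automorphisms of A, hence affine at p:
λ_a has a factor S(a) and a shift u(a). Put Ψ = χ_p ∘ π. Then S is a character of M; if χ_p ≠ 1 on
A, u is an S-cocycle, x_p ∘ π + Ψu is a ΨS-cocycle, and exactly one of them is nontrivial. That one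
is the coordinate of M up to an affine change. This gives two shapes of π at each p with χ_p ≠ 1 on
A, that is p ∣ g, and one shape elsewhere (`IsBraceEquiv.coord_form`).

Automorphisms of M and A remove all constants, except possibly at odd primes in `D` on both sides;
these do not occur in the cases counted here. The set T of primes with the twisted shape is then a
complete invariant, whence 2^ω(g). The obstruction is that a prime in `D` of A must have trivial
character on M; it fails for dihedral M when d > 2. -/

/-! ### Cocycles with values in a prime field -/

/-- `x` is a 1-cocycle for the action of `G` on `ZMod p` through the character `χ`. -/
def IsCocycle {G : Type*} [Group G] {p : ℕ} (χ : G →* (ZMod p)ˣ) (x : G → ZMod p) : Prop :=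
  ∀ a b, x (a * b) = x a + χ a * x b

/-- Some element acts as a nontrivial translation. -/
def IsNontrivialCocycle {G : Type*} [Group G] {p : ℕ} (χ : G →* (ZMod p)ˣ) (x : G → ZMod p) :
    Prop :=
  ∃ a, χ a = 1 ∧ x a ≠ 0

namespace IsCocycle

variable {G : Type*} [Group G] {p : ℕ} {χ χ' : G →* (ZMod p)ˣ} {x x' : G → ZMod p}

theorem map_one (h : IsCocycle χ x) : x 1 = 0 := by
  have := h 1 1
  simpa using this

theorem map_pow (h : IsCocycle χ x) {a : G} (ha : χ a = 1) (m : ℕ) : x (a ^ m) = m * x a := by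
  induction m with
  | zero => simp [h.map_one]
  | succ m ih => rw [pow_succ, h, ih, _root_.map_pow, ha]; push_cast; ring_nf

theorem map_inv (h : IsCocycle χ x) (a : G) : x a⁻¹ = -((χ a)⁻¹ : (ZMod p)ˣ) * x a := by
  have := h a⁻¹ a
  rw [inv_mul_cancel, h.map_one, _root_.map_inv] at this
  linear_combination -this

theorem map_conj (h : IsCocycle χ x) (a : G) {t : G} (ht : χ t = 1) :
    x (a * t * a⁻¹) = χ a * x t := by
  rw [h, h, h.map_inv, map_mul, ht]
  have := (χ a).mul_inv
  push_cast
  linear_combination - x a * this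

/-- If x vanishes on ker χ, it vanishes on the commutators ab(ba)⁻¹, so x(ab) = x(ba), i.e. x(a)(1 -
χ b) = x(b)(1 - χ a). Any b with χ b ≠ 1 then exhibits x as a coboundary. -/
theorem eq_coboundary_or_nontrivial [Fact p.Prime] (h : IsCocycle χ x) :
    (∃ c, ∀ a, x a = c * (1 - χ a)) ∨ IsNontrivialCocycle χ x := by
  by_cases hn : IsNontrivialCocycle χ x
  · exact Or.inr hn
  left
  unfold IsNontrivialCocycle at hn
  push Not at hn
  by_cases h1 : ∀ a, χ a = 1
  · exact ⟨0, fun a => by simp [hn a (h1 a)]⟩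
  push Not at h1
  obtain ⟨b, hb⟩ := h1
  have hb' : (1 : ZMod p) - χ b ≠ 0 := fun h0 => hb (Units.ext (by
    rw [Units.val_one]; linear_combination -h0))
  refine ⟨x b / (1 - χ b), fun a => ?_⟩
  have key : x (a * b * (b * a)⁻¹) = 0 := hn _ (by
    rw [map_mul, _root_.map_inv, map_mul, map_mul, mul_comm (χ b), mul_inv_cancel])
  rw [h, h.map_inv, h, h] at key
  have := (χ (a * b)).mul_inv
  rw [mul_comm (χ b) (χ a) |> fun e => show χ (b * a) = χ (a * b) by simp [e]] at key
  field_simp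
  linear_combination key + (x b + χ b * x a) * this

/-- A nontrivial cocycle is nontrivial at an element killed by any given second character. -/
theorem exists_translation [Fact p.Prime] (h : IsCocycle χ x) (hn : IsNontrivialCocycle χ x)
    (χ' : G →* (ZMod p)ˣ) : ∃ t, χ t = 1 ∧ χ' t = 1 ∧ x t ≠ 0 := by
  obtain ⟨a, ha, hx⟩ := hn
  -- The power p - 1 kills every character into (ℤ/p)ˣ, and it only multiplies x a by -1.
  refine ⟨a ^ (p - 1), by simp [ha], by rw [_root_.map_pow, ZMod.units_pow_card_sub_one_eq_one], ?_⟩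
  rw [h.map_pow ha, Nat.cast_sub (Fact.out : p.Prime).one_le]
  simpa using hx

/-- If `p ^ 2` does not divide the order of `G`, two cocycles are proportional on translations. -/
theorem det_eq_zero [Fact p.Prime] [Finite G] (hp : ¬ p ^ 2 ∣ Nat.card G)
    (h : IsCocycle χ x) (h' : IsCocycle χ' x') {s t : G} (hs : χ s = 1) (hs' : χ' s = 1)
    (ht : χ t = 1) (ht' : χ' t = 1) : x s * x' t - x t * x' s = 0 := by
  by_contra hd
  apply hp
  -- With a nonzero determinant, (x, x') would map the common kernel of the characters onto (ℤ/p)²,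
  -- so p² would divide |G|. The exponents of s and t below come from Cramer's rule.
  let K : Subgroup G := χ.ker ⊓ χ'.ker
  let φ : K →* Multiplicative (ZMod p × ZMod p) :=
    { toFun := fun a => Multiplicative.ofAdd (x a, x' a)
      map_one' := by simp [h.map_one, h'.map_one]
      map_mul' := by
        rintro ⟨a, ha⟩ ⟨b, hb⟩
        have ha1 : χ a = 1 := ha.1
        have ha2 : χ' a = 1 := ha.2
        simp [h a b, h' a b, ha1, ha2, ← ofAdd_add] }
  have hφ : Function.Surjective φ := by
    intro v
    obtain ⟨y, y'⟩ := v
    set D := x s * x' t - x t * x' s with hD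
    have hsK : s ∈ K := ⟨hs, hs'⟩
    have htK : t ∈ K := ⟨ht, ht'⟩
    refine ⟨⟨s, hsK⟩ ^ ((y * x' t - y' * x t) / D).val * ⟨t, htK⟩ ^ ((x s * y' - x' s * y) / D).val,
      ?_⟩
    have e1 : x (s ^ ((y * x' t - y' * x t) / D).val * t ^ ((x s * y' - x' s * y) / D).val) = y := by
      rw [h, h.map_pow hs, h.map_pow ht, _root_.map_pow, hs]
      simp only [ZMod.natCast_val, ZMod.cast_id', id, one_pow, Units.val_one]
      field_simp
      rw [hD]; ring
    have e2 : x' (s ^ ((y * x' t - y' * x t) / D).val * t ^ ((x s * y' - x' s * y) / D).val)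
        = y' := by
      rw [h', h'.map_pow hs', h'.map_pow ht', _root_.map_pow, hs']
      simp only [ZMod.natCast_val, ZMod.cast_id', id, one_pow, Units.val_one]
      field_simp
      rw [hD]; ring
    exact congrArg₂ (fun a b => Multiplicative.ofAdd (a, b)) e1 e2
  have h1 := Subgroup.card_dvd_of_surjective φ hφ
  have h2 : Nat.card (Multiplicative (ZMod p × ZMod p)) = p ^ 2 := by
    rw [Nat.card_congr Multiplicative.toAdd, Nat.card_prod, Nat.card_zmod, sq]
  rw [h2] at h1
  exact h1.trans (Subgroup.card_subgroup_dvd_card K)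

/-- Take a common translation t. Conjugation by a multiplies x t by χ a and x' t by χ' a;
proportionality on translations forces the two factors to agree. -/
theorem char_eq [Fact p.Prime] [Finite G] (hp : ¬ p ^ 2 ∣ Nat.card G)
    (h : IsCocycle χ x) (h' : IsCocycle χ' x') (hn : IsNontrivialCocycle χ x)
    (hn' : IsNontrivialCocycle χ' x') : χ = χ' := by
  obtain ⟨t, ht, ht', hx⟩ := h.exists_translation hn χ'
  obtain ⟨s, hs', hs, hx'⟩ := h'.exists_translation hn' χ
  have d1 := det_eq_zero hp h h' ht ht' hs hs'
  have hxt : x' t ≠ 0 := by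
    intro h0
    rw [h0, mul_zero, sub_zero] at d1
    exact (mul_ne_zero hx hx') d1
  ext a
  have d2 := det_eq_zero hp h h' ht ht' (t := a * t * a⁻¹) (by simp [ht]) (by simp [ht'])
  rw [h.map_conj a ht, h'.map_conj a ht'] at d2
  have : (x t * x' t) * ((χ a : ZMod p) - χ' a) = 0 := by linear_combination -d2
  have := (mul_eq_zero.1 this).resolve_left (mul_ne_zero hx hxt)
  linear_combination this

/-- The combination x(t)·x' - x'(t)·x is a cocycle that vanishes on all translations, hence a
coboundary. -/
theorem eq_affine [Fact p.Prime] [Finite G] (hp : ¬ p ^ 2 ∣ Nat.card G)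
    (h : IsCocycle χ x) (h' : IsCocycle χ x') (hn : IsNontrivialCocycle χ x)
    (hn' : IsNontrivialCocycle χ x') :
    ∃ r c, r ≠ 0 ∧ ∀ a, x' a = r * x a + c * (1 - χ a) := by
  obtain ⟨t, ht, hx⟩ := hn
  obtain ⟨s, hs, hx'⟩ := hn'
  have d1 := det_eq_zero hp h h' ht ht hs hs
  have hxt : x' t ≠ 0 := by
    intro h0
    rw [h0, mul_zero, sub_zero] at d1
    exact (mul_ne_zero hx hx') d1
  have hy : IsCocycle χ (fun a => x t * x' a - x' t * x a) := fun a b => by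
    simp only [h a b, h' a b]; ring
  rcases hy.eq_coboundary_or_nontrivial with ⟨c, hc⟩ | ⟨a, ha, hya⟩
  · refine ⟨x' t / x t, c / x t, div_ne_zero hxt hx, fun a => ?_⟩
    have := hc a
    field_simp
    linear_combination this
  · exact absurd (by linear_combination det_eq_zero hp h h' ht ht ha ha) hya

/-- A nontrivial cocycle does not vanish at elements of order `p`. -/
theorem ne_zero_of_orderOf_eq [Fact p.Prime] [Finite G] (hp : ¬ p ^ 2 ∣ Nat.card G)
    (h : IsCocycle χ x) (hn : IsNontrivialCocycle χ x) {b : G} (hb : orderOf b = p) : x b ≠ 0 := by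
  intro h0
  obtain ⟨t, ht, hx⟩ := hn
  have hχb : χ b = 1 := by
    have e : (χ b) ^ p = 1 := by
      rw [← _root_.map_pow, orderOf_dvd_iff_pow_eq_one.1 hb.dvd, _root_.map_one]
    ext
    have := congrArg Units.val e
    rwa [Units.val_pow_eq_pow_val, ZMod.pow_card] at this
  let φ : χ.ker →* Multiplicative (ZMod p) :=
    { toFun := fun a => Multiplicative.ofAdd (x a)
      map_one' := by simp [h.map_one]
      map_mul' := by
        rintro ⟨a, ha⟩ ⟨b, hb⟩
        rw [MonoidHom.mem_ker] at ha
        simp [h a b, ha, ← ofAdd_add] }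
  have hφ : Function.Surjective φ := by
    intro y
    refine ⟨⟨t, ht⟩ ^ (y.toAdd / x t).val, ?_⟩
    have : x (t ^ (y.toAdd / x t).val) = y.toAdd := by
      rw [h.map_pow ht]
      simp only [ZMod.natCast_val, ZMod.cast_id', id]
      field_simp
    exact congrArg Multiplicative.ofAdd this
  -- If x b = 0, then p divides the order of the kernel as well as that of the image of x on ker χ,
  -- so p² divides |G|.
  have hcard : Nat.card φ.ker * p = Nat.card χ.ker := by
    rw [← Subgroup.card_mul_index φ.ker, Subgroup.index_ker, MonoidHom.range_eq_top.2 hφ,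
      Subgroup.card_top, Nat.card_congr Multiplicative.toAdd, Nat.card_zmod]
  have hpk : p ∣ Nat.card φ.ker := by
    have hb1 : b ∈ χ.ker := hχb
    have hmem : (⟨b, hb1⟩ : χ.ker) ∈ φ.ker := by
      rw [MonoidHom.mem_ker]; exact congrArg Multiplicative.ofAdd h0
    have := orderOf_dvd_natCard (⟨⟨b, hb1⟩, hmem⟩ : φ.ker)
    rwa [Subgroup.orderOf_mk, Subgroup.orderOf_mk, hb] at this
  apply hp
  rw [sq]
  exact (Nat.mul_dvd_mul_right hpk p).trans (hcard ▸ Subgroup.card_subgroup_dvd_card _)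

theorem comp (h : IsCocycle χ x) {H : Type*} [Group H] (f : H →* G) :
    IsCocycle (χ.comp f) (fun a => x (f a)) := fun a b => by simp [h (f a) (f b)]

end IsCocycle

theorem IsNontrivialCocycle.comp {G H : Type*} [Group G] [Group H] {p : ℕ} {χ : G →* (ZMod p)ˣ}
    {x : G → ZMod p} (h : IsNontrivialCocycle χ x) {f : H →* G} (hf : Function.Surjective f) :
    IsNontrivialCocycle (χ.comp f) (fun a => x (f a)) := by
  obtain ⟨t, ht, hx⟩ := h
  obtain ⟨s, rfl⟩ := hf t
  exact ⟨s, ht, hx⟩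

/-! ### Coordinates on groups of squarefree order -/

instance factPrimeOfPrimeFactors {n : ℕ} (p : n.primeFactors) : Fact (p : ℕ).Prime :=
  ⟨Nat.prime_of_mem_primeFactors p.2⟩

/-- A nontrivial cocycle modulo each prime factor of `n`, with a set `D` of primes whose
coordinates are additive and carry the same information as the characters. -/
structure CoordSystem (G : Type*) [Group G] (n : ℕ) where
  χ : ∀ p : n.primeFactors, G →* (ZMod p)ˣ
  x : ∀ p : n.primeFactors, G → ZMod p
  isCocycle : ∀ p, IsCocycle (χ p) (x p)
  nontrivial : ∀ p, IsNontrivialCocycle (χ p) (x p)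
  D : Set n.primeFactors
  char_of_mem : ∀ p ∈ D, χ p = 1
  eq_on_iff : ∀ a b, (∀ p ∈ D, x p a = x p b) ↔ ∀ q, χ q a = χ q b

theorem not_sq_dvd_of_mem_primeFactors {n : ℕ} (hn : Squarefree n) (p : n.primeFactors) :
    ¬ (p : ℕ) ^ 2 ∣ n := fun h =>
  (Nat.prime_of_mem_primeFactors p.2).one_lt.ne' (by simpa using hn p (by rwa [← sq]))

namespace CoordSystem

variable {G : Type*} [Group G] {n : ℕ} (C : CoordSystem G n)

theorem injective (hn : Squarefree n) (hG : Nat.card G = n) :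
    Function.Injective (fun a p => C.x p a) := by
  have : Finite G := Nat.finite_of_card_ne_zero (hG ▸ hn.ne_zero)
  intro a b hab
  rw [← inv_mul_eq_one]
  set c := a⁻¹ * b with hc
  have hc0 : ∀ p, C.x p c = 0 := fun p => by
    have hp : C.x p a = C.x p b := congrFun hab p
    rw [hc, C.isCocycle, (C.isCocycle p).map_inv, hp, map_inv]
    ring
  by_contra h1
  have h1' : orderOf c ≠ 1 := fun h => h1 (orderOf_eq_one_iff.1 h)
  obtain ⟨p, hp, hpc⟩ := Nat.exists_prime_and_dvd h1'
  have : Fact p.Prime := ⟨hp⟩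
  have hpn : p ∈ n.primeFactors :=
    Nat.mem_primeFactors.2 ⟨hp, hpc.trans (hG ▸ orderOf_dvd_natCard c), hn.ne_zero⟩
  -- A nontrivial c with all coordinates zero has a power of prime order p, whose p-coordinate is
  -- also zero.
  have hord : orderOf (c ^ (orderOf c / p)) = p := orderOf_pow_orderOf_div (orderOf_pos c).ne' hpc
  refine (C.isCocycle ⟨p, hpn⟩).ne_zero_of_orderOf_eq
    (by rw [hG]; exact not_sq_dvd_of_mem_primeFactors hn _) (C.nontrivial ⟨p, hpn⟩) hord ?_
  generalize orderOf c / p = m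
  induction m with
  | zero => simp [(C.isCocycle ⟨p, hpn⟩).map_one]
  | succ m ih => rw [pow_succ, C.isCocycle, ih, hc0]; simp

theorem bijective (hn : Squarefree n) (hG : Nat.card G = n) :
    Function.Bijective (fun a p => C.x p a) := by
  have : Finite G := Nat.finite_of_card_ne_zero (hG ▸ hn.ne_zero)
  refine (Nat.bijective_iff_injective_and_card _).2 ⟨C.injective hn hG, ?_⟩
  rw [Nat.card_pi, hG]
  simp only [Nat.card_zmod]
  rw [Finset.prod_coe_sort n.primeFactors (fun p => p), Nat.prod_primeFactors_of_squarefree hn]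

/-- The element with given coordinates. -/
theorem exists_coord (hn : Squarefree n) (hG : Nat.card G = n) (v : ∀ p : n.primeFactors, ZMod p) :
    ∃ a, ∀ p, C.x p a = v p := by
  obtain ⟨a, ha⟩ := (C.bijective hn hG).2 v
  exact ⟨a, congrFun ha⟩

theorem ext (hn : Squarefree n) (hG : Nat.card G = n) {a b : G} (h : ∀ p, C.x p a = C.x p b) :
    a = b :=
  C.injective hn hG (funext h)

theorem char_comp_mulEquiv (hn : Squarefree n) (hG : Nat.card G = n) (β : G ≃* G)
    (p : n.primeFactors) (a : G) : C.χ p (β a) = C.χ p a := by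
  have : Finite G := Nat.finite_of_card_ne_zero (hG ▸ hn.ne_zero)
  have := IsCocycle.char_eq (by rw [hG]; exact not_sq_dvd_of_mem_primeFactors hn p)
    ((C.isCocycle p).comp β.toMonoidHom) (C.isCocycle p)
    ((C.nontrivial p).comp β.surjective) (C.nontrivial p)
  exact DFunLike.congr_fun this a

theorem coord_comp_mulEquiv (hn : Squarefree n) (hG : Nat.card G = n) (β : G ≃* G)
    (p : n.primeFactors) :
    ∃ r c, r ≠ 0 ∧ ∀ a, C.x p (β a) = r * C.x p a + c * (1 - C.χ p a) := by
  have : Finite G := Nat.finite_of_card_ne_zero (hG ▸ hn.ne_zero)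
  have e : (C.χ p).comp β.toMonoidHom = C.χ p :=
    MonoidHom.ext fun a => C.char_comp_mulEquiv hn hG β p a
  have h1 := (C.isCocycle p).comp β.toMonoidHom
  have h2 := (C.nontrivial p).comp (f := β.toMonoidHom) β.surjective
  rw [e] at h1 h2
  exact (C.isCocycle p).eq_affine (by rw [hG]; exact not_sq_dvd_of_mem_primeFactors hn p) h1
    (C.nontrivial p) h2

theorem coord_comp_mulEquiv_of_mem (hn : Squarefree n) (hG : Nat.card G = n) (β : G ≃* G)
    {p : n.primeFactors} (hp : p ∈ C.D) (a : G) : C.x p (β a) = C.x p a :=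
  (C.eq_on_iff _ _).2 (fun q => C.char_comp_mulEquiv hn hG β q a) p hp

/-- Every admissible affine change of coordinates comes from an automorphism. -/
theorem exists_mulEquiv (hn : Squarefree n) (hG : Nat.card G = n)
    (r c : ∀ p : n.primeFactors, ZMod p) (hr : ∀ p, r p ≠ 0) (hD : ∀ p ∈ C.D, r p = 1) :
    ∃ β : G ≃* G, ∀ p a, C.x p (β a) = r p * C.x p a + c p * (1 - C.χ p a) := by
  have : Finite G := Nat.finite_of_card_ne_zero (hG ▸ hn.ne_zero)
  choose f hf using fun a => C.exists_coord hn hG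
    (fun p => r p * C.x p a + c p * (1 - C.χ p a))
  -- The map fixes the coordinates in `D`, hence all characters; this is what makes it
  -- multiplicative.
  have hχ : ∀ q a, C.χ q (f a) = C.χ q a := fun q a =>
    (C.eq_on_iff _ _).1 (fun p hp => by rw [hf, hD p hp, C.char_of_mem p hp]; simp) q
  let φ : G →* G := MonoidHom.mk' f fun a b => C.ext hn hG fun p => by
    rw [C.isCocycle, hf, hf, hf, hχ, C.isCocycle, map_mul]
    push_cast
    ring
  have hφ : Function.Injective φ := fun a b hab => C.ext hn hG fun p => by
    have h1 : C.χ p a = C.χ p b := by rw [← hχ p a, ← hχ p b]; exact congrArg _ hab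
    have h2 : C.x p (f a) = C.x p (f b) := congrArg _ hab
    rw [hf, hf, h1] at h2
    exact mul_left_cancel₀ (hr p) (add_right_cancel h2)
  exact ⟨MulEquiv.ofBijective φ (Finite.injective_iff_bijective.1 hφ), fun p a => hf a p⟩

end CoordSystem

/-! ### Skew braces as bijections between groups -/

/-- The bijections `π : M ≃ A` along which the group law of `A` makes `M` a skew brace. -/
def IsBraceEquiv {M A : Type*} [Group M] [Group A] (π : M ≃ A) : Prop :=
  ∀ a b c b', π b' = π b * π c → π (a * b') = π (a * b) * (π a)⁻¹ * π (a * c)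

namespace IsBraceEquiv

/-- The skew brace structure on `M` obtained from the group law of `A`. -/
abbrev skewBrace {M A : Type u} [Group M] [Group A] {π : M ≃ A} (h : IsBraceEquiv π) :
    SkewBrace M :=
  { (π.trans Additive.ofMul).addGroup, ‹Group M› with
    mul_add_eq := fun a b c => π.injective (by
      refine (h a b c _ (π.apply_symm_apply _)).trans (Eq.symm ?_)
      refine (π.apply_symm_apply _).trans ?_
      refine congrArg (· * π (a * c)) ((π.apply_symm_apply _).trans ?_)
      exact congrArg (π (a * b) * ·) (π.apply_symm_apply _)) }

/-- The skew brace on `M` obtained from the group law of `A`, with its two isomorphisms. -/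
def toSkewBraceOn {M A : Type u} [Group M] [Group A] {π : M ≃ A} (h : IsBraceEquiv π) :
    SkewBraceOn M A where
  carrier := M
  inst := h.skewBrace
  mul_iso := ⟨MulEquiv.refl M⟩
  add_iso :=
    letI := h.skewBrace
    ⟨{ toFun := fun a => π (Multiplicative.toAdd a)
       invFun := fun a => Multiplicative.ofAdd (π.symm a)
       left_inv := fun _ => π.symm_apply_apply _
       right_inv := fun _ => π.apply_symm_apply _
       map_mul' := fun _ _ => π.apply_symm_apply _ }⟩

theorem exists_equiv {M A : Type u} [Group M] [Group A] (X : SkewBraceOn M A) :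
    ∃ (π : M ≃ A) (h : IsBraceEquiv π), X.Iso h.toSkewBraceOn := by
  obtain ⟨f⟩ := X.mul_iso
  obtain ⟨g⟩ := X.add_iso
  have hg : ∀ a b : X.carrier, g (Multiplicative.ofAdd (a + b)) =
      g (Multiplicative.ofAdd a) * g (Multiplicative.ofAdd b) := fun a b => map_mul g _ _
  have hg' : ∀ a : X.carrier, g (Multiplicative.ofAdd (-a)) = (g (Multiplicative.ofAdd a))⁻¹ :=
    fun a => map_inv g _
  let π : M ≃ A := f.symm.toEquiv.trans (Multiplicative.ofAdd.trans g.toEquiv)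
  have hπ : ∀ m, π m = g (Multiplicative.ofAdd (f.symm m)) := fun _ => rfl
  have h : IsBraceEquiv π := by
    intro a b c b' hb
    rw [hπ, hπ, hπ, ← hg] at hb
    have hb' : f.symm b' = f.symm b + f.symm c := Multiplicative.ofAdd.injective (g.injective hb)
    rw [hπ, hπ, hπ, hπ, map_mul, hb', SkewBrace.mul_add_eq, hg, hg, hg', map_mul f.symm,
      map_mul f.symm]
  refine ⟨π, h, f.toEquiv, fun a b => π.injective ?_, fun a b => map_mul f a b⟩
  refine Eq.trans ?_ (π.apply_symm_apply _).symm
  change π (f (a + b)) = π (f a) * π (f b)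
  simp only [hπ, MulEquiv.symm_apply_apply, hg]

theorem iso_iff {M A : Type u} [Group M] [Group A] {π π' : M ≃ A} (h : IsBraceEquiv π)
    (h' : IsBraceEquiv π') :
    h.toSkewBraceOn.Iso h'.toSkewBraceOn ↔
      ∃ (α : M ≃* M) (β : A ≃* A), ∀ a, β (π a) = π' (α a) := by
  constructor
  · rintro ⟨f, hadd, hmul⟩
    let f' : M ≃ M := f
    have hadd' : ∀ a b : M, f' (π.symm (π a * π b)) = π'.symm (π' (f' a) * π' (f' b)) := hadd
    refine ⟨MulEquiv.mk' f' hmul, MulEquiv.mk' ((π.symm.trans f').trans π') fun y z => ?_, ?_⟩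
    · have := hadd' (π.symm y) (π.symm z)
      simp only [Equiv.apply_symm_apply] at this
      simp [this]
    · intro a
      change π' (f' (π.symm (π a))) = π' (f' a)
      rw [Equiv.symm_apply_apply]
  · rintro ⟨α, β, hαβ⟩
    refine ⟨α.toEquiv, fun a b => ?_, fun a b => map_mul α a b⟩
    let a' : M := a
    let b' : M := b
    change α (π.symm (π a' * π b')) = π'.symm (π' (α a') * π' (α b'))
    rw [Equiv.eq_symm_apply, ← hαβ, ← hαβ, ← hαβ, Equiv.apply_symm_apply, map_mul]

/-- The lambda map of the skew brace, transported to `A`. -/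
def lam {M A : Type*} [Group M] [Group A] {π : M ≃ A} (h : IsBraceEquiv π) (a : M) : A ≃* A :=
  MulEquiv.mk' ((π.symm.trans (Equiv.mulLeft a)).trans (π.trans (Equiv.mulLeft (π a)⁻¹)))
    fun y z => by
      have := h a (π.symm y) (π.symm z) (π.symm (y * z)) (by simp)
      simp [this, mul_assoc]

theorem map_mul_eq {M A : Type*} [Group M] [Group A] {π : M ≃ A} (h : IsBraceEquiv π) (a b : M) :
    π (a * b) = π a * h.lam a (π b) := by
  simp [lam, MulEquiv.mk']

theorem lam_mul {M A : Type*} [Group M] [Group A] {π : M ≃ A} (h : IsBraceEquiv π) (a b : M)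
    (y : A) : h.lam (a * b) y = h.lam a (h.lam b y) := by
  obtain ⟨c, rfl⟩ := π.surjective y
  have h1 := h.map_mul_eq (a * b) c
  rw [mul_assoc, h.map_mul_eq a (b * c), h.map_mul_eq b c, map_mul, ← mul_assoc,
    ← h.map_mul_eq] at h1
  exact (mul_left_cancel h1).symm

end IsBraceEquiv

/-! ### Counting skew braces in coordinates -/

theorem CoordSystem.exists_translation_eq {G : Type*} [Group G] {n : ℕ} (C : CoordSystem G n)
    (p : n.primeFactors) (c : ZMod p) : ∃ a, C.χ p a = 1 ∧ C.x p a = c := by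
  obtain ⟨t, ht, hx⟩ := C.nontrivial p
  refine ⟨t ^ (c / C.x p t).val, by simp [ht], ?_⟩
  rw [(C.isCocycle p).map_pow ht]
  simp only [ZMod.natCast_val, ZMod.cast_id', id]
  field_simp

theorem CoordSystem.char_eq_of_isCocycle {G : Type*} [Group G] {n : ℕ} (C : CoordSystem G n)
    (hn : Squarefree n) (hG : Nat.card G = n) {p : n.primeFactors} {χ : G →* (ZMod p)ˣ}
    {x : G → ZMod p} (h : IsCocycle χ x) (hx : IsNontrivialCocycle χ x) : χ = C.χ p := by
  have : Finite G := Nat.finite_of_card_ne_zero (hG ▸ hn.ne_zero)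
  exact IsCocycle.char_eq (by rw [hG]; exact not_sq_dvd_of_mem_primeFactors hn p) h
    (C.isCocycle p) hx (C.nontrivial p)

theorem CoordSystem.eq_affine_of_isCocycle {G : Type*} [Group G] {n : ℕ} (C : CoordSystem G n)
    (hn : Squarefree n) (hG : Nat.card G = n) {p : n.primeFactors}
    {x : G → ZMod p} (h : IsCocycle (C.χ p) x) (hx : IsNontrivialCocycle (C.χ p) x) :
    ∃ r c, r ≠ 0 ∧ ∀ a, x a = r * C.x p a + c * (1 - C.χ p a) := by
  have : Finite G := Nat.finite_of_card_ne_zero (hG ▸ hn.ne_zero)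
  exact (C.isCocycle p).eq_affine (by rw [hG]; exact not_sq_dvd_of_mem_primeFactors hn p) h
    (C.nontrivial p) hx

/-! ### The shape of a brace bijection at each prime. -/

namespace IsBraceEquiv

variable {M A : Type*} [Group M] [Group A] {n : ℕ} {π : M ≃ A}

/-- The characters of `A` along a brace bijection are characters of `M`. -/
def pullChar (h : IsBraceEquiv π) (CA : CoordSystem A n) (hn : Squarefree n)
    (hA : Nat.card A = n) (p : n.primeFactors) : M →* (ZMod p)ˣ :=
  MonoidHom.mk' (fun a => CA.χ p (π a)) fun a b => by
    rw [h.map_mul_eq, map_mul, CA.char_comp_mulEquiv hn hA]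

theorem pullChar_apply (h : IsBraceEquiv π) (CA : CoordSystem A n) (hn : Squarefree n)
    (hA : Nat.card A = n) (p : n.primeFactors) (a : M) :
    h.pullChar CA hn hA p a = CA.χ p (π a) := rfl

/-- At a prime of `D` the lambda maps fix x_p, so x_p ∘ π is a nontrivial additive cocycle on M;
uniqueness of the character makes that of M trivial. This is the obstruction to existence. -/
theorem char_eq_one_of_mem (h : IsBraceEquiv π) (CM : CoordSystem M n)
    (CA : CoordSystem A n) (hn : Squarefree n) (hM : Nat.card M = n) (hA : Nat.card A = n)
    {p : n.primeFactors} (hp : p ∈ CA.D) : CM.χ p = 1 := by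
  have h1 : h.pullChar CA hn hA p = 1 := MonoidHom.ext fun a => by
    rw [pullChar_apply, CA.char_of_mem p hp]; rfl
  rw [← h1]
  refine (CM.char_eq_of_isCocycle hn hM (x := fun a => CA.x p (π a)) ?_ ?_).symm
  · intro a b
    beta_reduce
    rw [h.map_mul_eq, CA.isCocycle, CA.coord_comp_mulEquiv_of_mem hn hA _ hp]
    rfl
  · obtain ⟨t, ht, hx⟩ := CA.nontrivial p
    exact ⟨π.symm t, by simp [pullChar_apply, ht], by simpa using hx⟩

/-- The two possible shapes of the coordinates along a brace bijection. -/
theorem coord_form (h : IsBraceEquiv π) (CM : CoordSystem M n)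
    (CA : CoordSystem A n) (hn : Squarefree n) (hM : Nat.card M = n) (hA : Nat.card A = n)
    (p : n.primeFactors) : ∃ r c c', r ≠ 0 ∧
    ((∀ a, CA.x p (π a) = c' * (1 - CA.χ p (π a)) + (r * CM.x p a + c * (1 - CM.χ p a))) ∨
      (CA.χ p ≠ 1 ∧ ∀ a, CA.x p (π a) =
        c' * (1 - CA.χ p (π a)) + CA.χ p (π a) * (r * CM.x p a + c * (1 - CM.χ p a)))) := by
  choose s u hs hu using fun a => CA.coord_comp_mulEquiv hn hA (h.lam a) p
  obtain ⟨t, ht, hx⟩ := CA.nontrivial p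
  set Ψ := h.pullChar CA hn hA p
  have hΨa : ∀ a, CA.χ p (π a) = Ψ a := fun _ => rfl
  have hX : ∀ a b, CA.x p (π (a * b)) =
      CA.x p (π a) + Ψ a * (s a * CA.x p (π b) + u a * (1 - Ψ b)) := fun a b => by
    rw [h.map_mul_eq, CA.isCocycle, hu]; rfl
  have hsm : ∀ a b, s (a * b) = s a * s b := fun a b => by
    have := hu (a * b) t
    rw [h.lam_mul, hu, hu, CA.char_comp_mulEquiv hn hA, ht, Units.val_one] at this
    refine mul_right_cancel₀ hx ?_
    linear_combination -this
  let S : M →* (ZMod p)ˣ := MonoidHom.mk' (fun a => Units.mk0 (s a) (hs a)) fun a b =>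
    Units.ext (by simp [hsm])
  have hS : ∀ a, (S a : ZMod p) = s a := fun a => rfl
  have htr : ∀ c, ∃ a, Ψ a = 1 ∧ CA.x p (π a) = c := fun c => by
    obtain ⟨y, hy, hyc⟩ := CA.exists_translation_eq p c
    exact ⟨π.symm y, by rw [← hΨa, Equiv.apply_symm_apply, hy], by rwa [Equiv.apply_symm_apply]⟩
  by_cases hψ : CA.χ p = 1
  · have hΨ1 : ∀ a, Ψ a = 1 := fun a => by rw [← hΨa, hψ]; rfl
    have hc : IsCocycle S (fun a => CA.x p (π a)) := fun a b => by
      simp only [hX, hΨ1, hS, Units.val_one]; ring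
    have hnt : IsNontrivialCocycle S (fun a => CA.x p (π a)) := by
      -- If x_p ∘ π = c(1 - S), the value c is never attained unless c = 0, and then x_p vanishes.
      refine hc.eq_coboundary_or_nontrivial.resolve_left ?_
      rintro ⟨c, hc⟩
      obtain ⟨a, -, ha⟩ := htr c
      rw [hc a, hS] at ha
      have hc0 : c = 0 := (mul_eq_zero.1 (show c * s a = 0 by linear_combination -ha)).resolve_right
        (hs a)
      apply hx
      simpa [hc0] using hc (π.symm t)
    have hSχ := CM.char_eq_of_isCocycle hn hM hc hnt
    rw [hSχ] at hc hnt
    obtain ⟨r, c, hr, hrc⟩ := CM.eq_affine_of_isCocycle hn hM hc hnt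
    exact ⟨r, c, 0, hr, Or.inl fun a => by rw [hrc]; ring⟩
  obtain ⟨y, hy⟩ : ∃ y, CA.χ p y ≠ 1 := by
    by_contra hcon
    push Not at hcon
    exact hψ (MonoidHom.ext hcon)
  have hy' : (1 : ZMod p) - CA.χ p y ≠ 0 := fun h0 => hy (Units.ext (by
    rw [Units.val_one]; linear_combination -h0))
  have hcu : IsCocycle S u := fun a b => by
    have := hu (a * b) y
    rw [h.lam_mul, hu, hu, CA.char_comp_mulEquiv hn hA, hsm] at this
    refine mul_right_cancel₀ hy' ?_
    rw [hS]
    linear_combination -this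
  -- This cocycle complements u: x_p ∘ π is recovered as the difference of it and Ψu.
  have hcv : IsCocycle (Ψ * S) (fun a => CA.x p (π a) + Ψ a * u a) := fun a b => by
    simp only [hX, hcu a b, MonoidHom.mul_apply, Units.val_mul, hS, map_mul]; ring
  rcases hcu.eq_coboundary_or_nontrivial with ⟨c', hc'⟩ | hntu
  · rcases hcv.eq_coboundary_or_nontrivial with ⟨c, hc⟩ | hntv
    -- Both are coboundaries: on ker Ψ, x_p ∘ π = (c - c')(1 - S). Attaining the value c - c' forces
    -- c = c', and then the value 1 is not attained.
    · exfalso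
      obtain ⟨a, ha, hac⟩ := htr (c - c')
      have := hc a
      simp only [hac, ha, hc' a, hS, MonoidHom.mul_apply, one_mul, Units.val_one] at this
      have hcc : (c - c') * s a = 0 := by linear_combination this
      have hcc := (mul_eq_zero.1 hcc).resolve_right (hs a)
      obtain ⟨a, ha, hac⟩ := htr 1
      have := hc a
      simp only [hac, ha, hc' a, hS, MonoidHom.mul_apply, one_mul, Units.val_one] at this
      exact one_ne_zero (show (1 : ZMod p) = 0 by linear_combination this + (1 - s a) * hcc)
    · have hSχ := CM.char_eq_of_isCocycle hn hM hcv hntv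
      have hSχ' : ∀ a, (Ψ a : ZMod p) * s a = CM.χ p a := fun a => by rw [← hSχ]; rfl
      rw [hSχ] at hcv hntv
      obtain ⟨r, c, hr, hrc⟩ := CM.eq_affine_of_isCocycle hn hM hcv hntv
      refine ⟨r, c - c', c', hr, Or.inl fun a => ?_⟩
      have := hrc a
      rw [hc' a, hS] at this
      rw [hΨa]
      linear_combination this + c' * hSχ' a
  · rcases hcv.eq_coboundary_or_nontrivial with ⟨c', hc'⟩ | hntv
    · have hSχ := CM.char_eq_of_isCocycle hn hM hcu hntu
      have hSχ' : ∀ a, s a = CM.χ p a := fun a => by rw [← hSχ]; rfl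
      rw [hSχ] at hcu hntu
      obtain ⟨r, c, hr, hrc⟩ := CM.eq_affine_of_isCocycle hn hM hcu hntu
      refine ⟨-r, c' - c, c', neg_ne_zero.2 hr, Or.inr ⟨hψ, fun a => ?_⟩⟩
      have := hc' a
      rw [hrc, MonoidHom.mul_apply, Units.val_mul, hS, hSχ'] at this
      rw [hΨa]
      linear_combination this
    -- Both are nontrivial: S and ΨS both equal the character of M, so Ψ = 1.
    · exfalso
      have h1 := CM.char_eq_of_isCocycle hn hM hcu hntu
      have h2 := CM.char_eq_of_isCocycle hn hM hcv hntv
      rw [← h1] at h2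
      have h3 : ∀ a, Ψ a = 1 := fun a => by
        have := DFunLike.congr_fun h2 a
        rwa [MonoidHom.mul_apply, mul_eq_right] at this
      exact hy (by simpa [← hΨa] using h3 (π.symm y))

end IsBraceEquiv

/-! ### Normal forms and their classification. -/

/-- The normal form of a brace bijection, relative to coordinates on `M` and `A`. -/
def IsStandardEquiv {M A : Type*} [Group M] [Group A] {n : ℕ} (CM : CoordSystem M n)
    (CA : CoordSystem A n) (T : Finset n.primeFactors) (π : M ≃ A) : Prop :=
  ∀ p a, CA.x p (π a) = (if p ∈ T then (CA.χ p (π a) : ZMod p) else 1) * CM.x p a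

namespace IsStandardEquiv

variable {M A : Type*} [Group M] [Group A] {n : ℕ} {CM : CoordSystem M n}
  {CA : CoordSystem A n} {T : Finset n.primeFactors}

theorem eq {π π' : M ≃ A} (hn : Squarefree n) (hA : Nat.card A = n)
    (hT : ∀ p ∈ T, CA.χ p ≠ 1) (h : IsStandardEquiv CM CA T π) (h' : IsStandardEquiv CM CA T π') :
    π = π' := by
  ext a
  have hχ : ∀ q, CA.χ q (π a) = CA.χ q (π' a) := (CA.eq_on_iff _ _).1 fun p hp => by
    have : p ∉ T := fun hpT => hT p hpT (CA.char_of_mem p hp)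
    rw [h, h', if_neg this, if_neg this]
  exact CA.ext hn hA fun p => by rw [h, h', hχ]

/-- Since T avoids `CA.D`, the coordinates of π there are those of M, additive by `hD`; so the
characters of A are multiplicative along π. The brace law can then be checked at each prime. -/
theorem isBraceEquiv {π : M ≃ A} (hn : Squarefree n) (hA : Nat.card A = n)
    (hT : ∀ p ∈ T, CA.χ p ≠ 1) (hD : ∀ p ∈ CA.D, CM.χ p = 1) (h : IsStandardEquiv CM CA T π) :
    IsBraceEquiv π := by
  have hχ : ∀ a b q, CA.χ q (π (a * b)) = CA.χ q (π a) * CA.χ q (π b) := fun a b q => by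
    rw [← map_mul]
    refine (CA.eq_on_iff _ _).1 (fun p hp => ?_) q
    have hpT : p ∉ T := fun hpT => hT p hpT (CA.char_of_mem p hp)
    rw [CA.isCocycle, h, h, h, if_neg hpT, CA.char_of_mem p hp, CM.isCocycle, hD p hp]
    simp
  intro a b c b' hb
  refine CA.ext hn hA fun p => ?_
  have hb1 := congrArg (CA.x p) hb
  have hb2 := congrArg (CA.χ p) hb
  rw [map_mul] at hb2
  rw [CA.isCocycle] at hb1 ⊢
  rw [CA.isCocycle, (CA.isCocycle p).map_inv, map_mul (CA.χ p), map_inv]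
  simp only [h p, hχ, CM.isCocycle p a, hb2] at hb1 ⊢
  have hu : (CA.χ p (π a) : ZMod p) * (CA.χ p (π a) : ZMod p)⁻¹ = 1 :=
    mul_inv_cancel₀ (Units.ne_zero _)
  split_ifs at hb1 ⊢ with hp
  · push_cast at hb1 ⊢
    generalize ((CA.χ p (π a) : (ZMod p)ˣ) : ZMod p) = j at *
    linear_combination j * (CM.χ p a : ZMod p) * hb1 - j * (CA.χ p (π b) : ZMod p) *
      ((CA.χ p (π c) : ZMod p) * (CM.x p a + (CM.χ p a : ZMod p) * CM.x p c) - CM.x p a) * hu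
  · push_cast at hb1 ⊢
    generalize ((CA.χ p (π a) : (ZMod p)ˣ) : ZMod p) = j at *
    linear_combination (CM.χ p a : ZMod p) * hb1 -
      (CM.χ p a : ZMod p) * (CA.χ p (π b) : ZMod p) * CM.x p c * hu

theorem exists_standard (hn : Squarefree n) (hM : Nat.card M = n) (hA : Nat.card A = n)
    (hT : ∀ p ∈ T, CA.χ p ≠ 1) : ∃ π : M ≃ A, IsStandardEquiv CM CA T π := by
  have : Finite M := Nat.finite_of_card_ne_zero (hM ▸ hn.ne_zero)
  have : Finite A := Nat.finite_of_card_ne_zero (hA ▸ hn.ne_zero)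
  -- The normal form mentions characters at π a itself. The untwisted map f has the same
  -- `D`-coordinates, hence the same characters, and breaks the circularity.
  choose f hf using fun a => CA.exists_coord hn hA (fun p => CM.x p a)
  choose g hg using fun a => CA.exists_coord hn hA
    (fun p => (if p ∈ T then (CA.χ p (f a) : ZMod p) else 1) * CM.x p a)
  have hχ : ∀ a q, CA.χ q (f a) = CA.χ q (g a) := fun a => (CA.eq_on_iff _ _).1 fun p hp => by
    have : p ∉ T := fun hpT => hT p hpT (CA.char_of_mem p hp)
    rw [hf, hg, if_neg this, one_mul]
  have hinj : Function.Injective g := fun a b hab => CM.ext hn hM fun p => by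
    have h1 := congrArg (CA.x p) hab
    rw [hg, hg, hχ, hχ, hab] at h1
    refine mul_left_cancel₀ ?_ h1
    split_ifs
    · exact Units.ne_zero _
    · exact one_ne_zero
  refine ⟨Equiv.ofBijective g ((Nat.bijective_iff_injective_and_card g).2
    ⟨hinj, hM.trans hA.symm⟩), fun p a => ?_⟩
  change CA.x p (g a) = (if p ∈ T then (CA.χ p (g a) : ZMod p) else 1) * CM.x p a
  rw [hg, hχ]

/-- At p ∈ T \ T', Ψ·x_p and x_p would agree up to scaling and coboundaries. Left multiplication by
a translation t ∈ ker Ψ changes them by multiples of Ψ(a) x_p(t) and x_p(t), so Ψ would be constant.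
-/
theorem subset_of_conj {T' : Finset n.primeFactors} {π π' : M ≃ A} (hn : Squarefree n)
    (hM : Nat.card M = n) (hA : Nat.card A = n) (hT : ∀ p ∈ T, CA.χ p ≠ 1)
    (h : IsStandardEquiv CM CA T π) (h' : IsStandardEquiv CM CA T' π') (hπ : IsBraceEquiv π)
    (α : M ≃* M) (β : A ≃* A) (hαβ : ∀ a, β (π a) = π' (α a)) : T ⊆ T' := by
  intro p hp
  by_contra hp'
  obtain ⟨r, c, hr, hrc⟩ := CA.coord_comp_mulEquiv hn hA β p
  obtain ⟨r', c', -, hrc'⟩ := CM.coord_comp_mulEquiv hn hM α p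
  set Ψ := hπ.pullChar CA hn hA p
  have hΨa : ∀ a, CA.χ p (π a) = Ψ a := fun _ => rfl
  have key : ∀ a, r * (Ψ a * CM.x p a) + c * (1 - Ψ a) =
      r' * CM.x p a + c' * (1 - CM.χ p a) := fun a => by
    have := congrArg (CA.x p) (hαβ a)
    rw [hrc, h, h', if_pos hp, if_neg hp', one_mul, hrc', hΨa] at this
    exact this
  obtain ⟨t, ht, ht', hx⟩ := (CM.isCocycle p).exists_translation (CM.nontrivial p) Ψ
  have k1 := key t
  rw [ht, ht', Units.val_one] at k1
  apply hT p hp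
  ext y
  have k2 := key (π.symm y)
  have k3 := key (t * π.symm y)
  rw [CM.isCocycle, map_mul, map_mul, ht, ht', one_mul, one_mul, Units.val_one] at k3
  have k4 : r * CM.x p t * ((Ψ (π.symm y) : ZMod p) - 1) = 0 := by
    linear_combination k3 - k2 - k1
  have k5 := (mul_eq_zero.1 k4).resolve_left (mul_ne_zero hr hx)
  rw [← hΨa, Equiv.apply_symm_apply] at k5
  rw [MonoidHom.one_apply, Units.val_one]
  linear_combination k5

end IsStandardEquiv

/-- Every brace bijection can be brought into normal form by automorphisms. -/
theorem IsBraceEquiv.exists_isStandardEquiv {M A : Type*} [Group M] [Group A] {n : ℕ} {π : M ≃ A}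
    (h : IsBraceEquiv π) (CM : CoordSystem M n) (CA : CoordSystem A n) (hn : Squarefree n)
    (hM : Nat.card M = n) (hA : Nat.card A = n)
    (hDD : ∀ p ∈ CA.D, p ∈ CM.D → (p : ℕ) = 2) :
    ∃ (T : Finset n.primeFactors) (α : M ≃* M) (β : A ≃* A), (∀ p ∈ T, CA.χ p ≠ 1) ∧
      IsStandardEquiv CM CA T ((α.toEquiv.trans π).trans β.toEquiv) := by
  classical
  choose r c c' hr hform using fun p => h.coord_form CM CA hn hM hA p
  -- The constant r is absorbed by A, except at primes of `CA.D`, where A cannot rescale and M must.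
  -- If M cannot either, then p = 2 and r = 1.
  let ρ : ∀ p : n.primeFactors, ZMod p := fun p => if p ∈ CA.D then (r p)⁻¹ else 1
  have hρ : ∀ p, ρ p ≠ 0 := fun p => by
    simp only [ρ]; split_ifs
    · exact inv_ne_zero (hr p)
    · exact one_ne_zero
  have hρD : ∀ p ∈ CM.D, ρ p = 1 := fun p hp => by
    simp only [ρ]; split_ifs with hpA
    · have h2 := hDD p hpA hp
      have := hr p
      revert this
      generalize r p = s
      obtain ⟨q, hq⟩ := p
      dsimp only at h2
      subst h2
      exact fun hs => inv_eq_one.2 ((by decide : ∀ s : ZMod 2, s ≠ 0 → s = 1) s hs)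
    · rfl
  obtain ⟨α, hα⟩ := CM.exists_mulEquiv hn hM ρ (fun p => -(c p / r p)) hρ hρD
  obtain ⟨β, hβ⟩ := CA.exists_mulEquiv hn hA (fun p => (r p * ρ p)⁻¹)
    (fun p => -((r p * ρ p)⁻¹ * c' p)) (fun p => inv_ne_zero (mul_ne_zero (hr p) (hρ p)))
    (fun p hp => by simp [ρ, hp, hr p])
  refine ⟨Finset.univ.filter fun p => CA.χ p ≠ 1 ∧ ∀ a, CA.x p (π a) =
        c' p * (1 - CA.χ p (π a)) + CA.χ p (π a) * (r p * CM.x p a + c p * (1 - CM.χ p a)),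
    α, β, fun p hp => (Finset.mem_filter.1 hp).2.1, fun p a => ?_⟩
  change CA.x p (β (π (α a))) = (if _ then (CA.χ p (β (π (α a))) : ZMod p) else 1) * _
  rw [hβ, CA.char_comp_mulEquiv hn hA]
  have hr' := hr p
  have hρ' := hρ p
  have hin : r p * CM.x p (α a) + c p * (1 - CM.χ p (α a)) = r p * ρ p * CM.x p a := by
    rw [hα, CM.char_comp_mulEquiv hn hM]
    field_simp
    ring
  split_ifs with hp
  · rw [(Finset.mem_filter.1 hp).2.2, hin]
    field_simp
    ring
  · rw [(hform p).resolve_right fun h2 => hp (Finset.mem_filter.2 ⟨Finset.mem_univ _, h2⟩), hin]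
    field_simp
    ring

theorem numSkewBraces_eq_two_pow {M A : Type u} [Group M] [Group A] {n : ℕ}
    (CM : CoordSystem M n) (CA : CoordSystem A n) (hn : Squarefree n)
    (hM : Nat.card M = n) (hA : Nat.card A = n) (hD : ∀ p ∈ CA.D, CM.χ p = 1)
    (hDD : ∀ p ∈ CA.D, p ∈ CM.D → (p : ℕ) = 2) (P : Finset n.primeFactors)
    (hP : ∀ p, p ∈ P ↔ CA.χ p ≠ 1) : numSkewBraces M A = 2 ^ P.card := by
  have hT : ∀ T : P.powerset, ∀ p ∈ T.1, CA.χ p ≠ 1 := fun T p hp =>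
    (hP p).1 (Finset.mem_powerset.1 T.2 hp)
  choose π hπ using fun T : P.powerset =>
    IsStandardEquiv.exists_standard (CM := CM) hn hM hA (hT T)
  have hb : ∀ T, IsBraceEquiv (π T) := fun T => (hπ T).isBraceEquiv hn hA (hT T) hD
  let F : P.powerset → Quotient (SkewBraceOn.setoid M A) := fun T => ⟦(hb T).toSkewBraceOn⟧
  have hF : Function.Bijective F := by
    constructor
    · intro T T' hTT'
      obtain ⟨α, β, hαβ⟩ := ((hb T).iso_iff (hb T')).1 (Quotient.exact hTT')
      obtain ⟨α', β', hαβ'⟩ := ((hb T').iso_iff (hb T)).1 (Quotient.exact hTT'.symm)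
      exact Subtype.ext (Finset.Subset.antisymm
        ((hπ T).subset_of_conj hn hM hA (hT T) (hπ T') (hb T) α β hαβ)
        ((hπ T').subset_of_conj hn hM hA (hT T') (hπ T) (hb T') α' β' hαβ'))
    · intro X
      induction X using Quotient.inductionOn with | _ X
      obtain ⟨π', h', hX⟩ := IsBraceEquiv.exists_equiv X
      obtain ⟨T, α, β, hTP, hst⟩ := h'.exists_isStandardEquiv CM CA hn hM hA hDD
      let T' : P.powerset := ⟨T, Finset.mem_powerset.2 fun p hp => (hP p).2 (hTP p hp)⟩
      have e := (hπ T').eq hn hA hTP hst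
      refine ⟨T', Quotient.sound ?_⟩
      refine Setoid.trans (b := h'.toSkewBraceOn) ?_ (Setoid.symm hX)
      refine ((hb T').iso_iff h').2 ⟨α, β.symm, fun a => ?_⟩
      rw [e]
      exact β.symm_apply_apply _
  rw [numSkewBraces, ← ENat.card_congr (Equiv.ofBijective F hF), ENat.card_eq_coe_fintype_card,
    Fintype.card_coe, Finset.card_powerset]
  norm_num

theorem numSkewBraces_eq_zero {M A : Type u} [Group M] [Group A] {n : ℕ}
    (CM : CoordSystem M n) (CA : CoordSystem A n) (hn : Squarefree n)
    (hM : Nat.card M = n) (hA : Nat.card A = n) {p : n.primeFactors} (hp : p ∈ CA.D)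
    (hχ : CM.χ p ≠ 1) : numSkewBraces M A = 0 := by
  rw [numSkewBraces, ENat.card_eq_zero_iff_empty]
  refine ⟨fun X => ?_⟩
  induction X using Quotient.inductionOn with | _ X
  obtain ⟨π, h, -⟩ := IsBraceEquiv.exists_equiv X
  exact hχ (h.char_eq_one_of_mem CM CA hn hM hA hp)

/-! ### The metacyclic groups `G(d, e, k)` -/

namespace MetacyclicGroup

variable {d e : ℕ} {k : ℤ}

/-- The generator `σ`. -/
def sigma (d e : ℕ) (k : ℤ) : MetacyclicGroup d e k := PresentedGroup.of 0

/-- The generator `τ`. -/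
def tau (d e : ℕ) (k : ℤ) : MetacyclicGroup d e k := PresentedGroup.of 1

theorem sigma_pow : sigma d e k ^ e = 1 :=
  PresentedGroup.one_of_mem (rels := metacyclicRels d e k) (x := FreeGroup.of 0 ^ e)
    (by simp [metacyclicRels])

theorem tau_pow : tau d e k ^ d = 1 :=
  PresentedGroup.one_of_mem (rels := metacyclicRels d e k) (x := FreeGroup.of 1 ^ d)
    (by simp [metacyclicRels])

theorem tau_mul_sigma : tau d e k * sigma d e k = sigma d e k ^ k * tau d e k := by
  have := PresentedGroup.one_of_mem (rels := metacyclicRels d e k)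
    (x := FreeGroup.of 1 * FreeGroup.of 0 * (FreeGroup.of 1)⁻¹ * (FreeGroup.of 0 ^ k)⁻¹)
    (by simp [metacyclicRels])
  have h : tau d e k * sigma d e k * (tau d e k)⁻¹ * (sigma d e k ^ k)⁻¹ = 1 := this
  rwa [mul_inv_eq_one, mul_inv_eq_iff_eq_mul] at h

theorem closure_eq_top :
    Subgroup.closure {sigma d e k, tau d e k} = (⊤ : Subgroup (MetacyclicGroup d e k)) := by
  rw [← PresentedGroup.closure_range_of]
  congr 1
  ext x
  simp [Set.mem_range, Fin.exists_fin_two, eq_comm, sigma, tau]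

/-- The homomorphism given by a pair of elements satisfying the relations. -/
theorem exists_hom {G : Type*} [Group G] {s t : G} (hs : s ^ e = 1) (ht : t ^ d = 1)
    (hst : t * s = s ^ k * t) :
    ∃ φ : MetacyclicGroup d e k →* G, φ (sigma d e k) = s ∧ φ (tau d e k) = t := by
  have h : ∀ r ∈ metacyclicRels d e k, FreeGroup.lift ![s, t] r = 1 := by
    rintro r (rfl | rfl | rfl)
    · simpa using hs
    · simpa using ht
    · simp [hst]
  exact ⟨PresentedGroup.toGroup h, PresentedGroup.toGroup.of h, PresentedGroup.toGroup.of h⟩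

theorem exists_eq_zpow_mul_zpow (hd : d ≠ 0) (g : MetacyclicGroup d e k) :
    ∃ i j : ℤ, g = sigma d e k ^ i * tau d e k ^ j := by
  have htau : ∀ (m : ℕ) (y : MetacyclicGroup d e k),
      (∃ i j : ℤ, y = sigma d e k ^ i * tau d e k ^ j) →
      ∃ i j : ℤ, tau d e k ^ m * y = sigma d e k ^ i * tau d e k ^ j := by
    intro m y hy
    induction m with
    | zero => simpa using hy
    | succ m ih =>
      obtain ⟨i, j, hij⟩ := ih
      refine ⟨k * i, j + 1, ?_⟩
      have hc : SemiconjBy (tau d e k) (sigma d e k) (sigma d e k ^ k) := tau_mul_sigma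
      have := (hc.zpow_right i).eq
      rw [pow_succ', mul_assoc, hij, ← mul_assoc, this, ← zpow_mul, mul_assoc, ← zpow_one_add,
        add_comm 1 j]
  have hg : g ∈ Subgroup.closure {sigma d e k, tau d e k} := by rw [closure_eq_top]; trivial
  induction hg using Subgroup.closure_induction_left with
  | one => exact ⟨0, 0, by simp⟩
  | mul_left x hx y _ ih =>
    rcases hx with rfl | rfl
    · obtain ⟨i, j, rfl⟩ := ih
      exact ⟨1 + i, j, by rw [zpow_one_add, mul_assoc]⟩
    · simpa using htau 1 y ih
  | inv_mul_cancel x hx y _ ih =>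
    rcases hx with rfl | rfl
    · obtain ⟨i, j, rfl⟩ := ih
      exact ⟨-1 + i, j, by rw [zpow_add, zpow_neg_one, mul_assoc]⟩
    -- Writing τ⁻¹ as a positive power avoids inverting k modulo e.
    · have : (tau d e k)⁻¹ = tau d e k ^ (d - 1) := by
        rw [inv_eq_iff_mul_eq_one, ← pow_succ', Nat.sub_add_cancel (Nat.pos_of_ne_zero hd), tau_pow]
      rw [this]
      exact htau _ y ih

end MetacyclicGroup

/-! ### Existence of the parameters. -/

/-- A cyclic normal subgroup with a cyclic complement acting faithfully gives parameters. -/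
theorem hasParameters_of_isComplement {A : Type*} [Group A] [Finite A] {E H : Subgroup A}
    [E.Normal] [IsCyclic E] [IsCyclic H] (hEH : E.IsComplement' H)
    (hcop : (Nat.card H).Coprime (Nat.card E)) (hf : Subgroup.centralizer (E : Set A) ≤ E) :
    ∃ k : ℤ, HasParameters A (Nat.card A) (Nat.card H) (Nat.card E) k := by
  obtain ⟨⟨s, hsE⟩, hs⟩ := IsCyclic.exists_generator (α := E)
  obtain ⟨⟨t, htH⟩, ht⟩ := IsCyclic.exists_generator (α := H)
  have hs' : Subgroup.zpowers s = E := by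
    refine le_antisymm (Subgroup.zpowers_le.2 hsE) fun x hx => ?_
    obtain ⟨i, hi⟩ := hs ⟨x, hx⟩
    exact ⟨i, congrArg Subtype.val hi⟩
  have ht' : Subgroup.zpowers t = H := by
    refine le_antisymm (Subgroup.zpowers_le.2 htH) fun x hx => ?_
    obtain ⟨i, hi⟩ := ht ⟨x, hx⟩
    exact ⟨i, congrArg Subtype.val hi⟩
  have hos : orderOf s = Nat.card E := by rw [← hs', Nat.card_zpowers]
  have hot : orderOf t = Nat.card H := by rw [← ht', Nat.card_zpowers]
  obtain ⟨k, hk⟩ : t * s * t⁻¹ ∈ Subgroup.zpowers s := by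
    rw [hs']; exact Subgroup.Normal.conj_mem ‹_› s hsE t
  have hk : s ^ k = t * s * t⁻¹ := hk
  have hconj : ∀ j : ℕ, t ^ j * s * (t ^ j)⁻¹ = s ^ (k ^ j) := by
    intro j
    induction j with
    | zero => simp
    | succ j ih =>
      calc t ^ (j + 1) * s * (t ^ (j + 1))⁻¹ = t * (t ^ j * s * (t ^ j)⁻¹) * t⁻¹ := by
            rw [pow_succ']; group
        _ = s ^ k ^ (j + 1) := by rw [ih, ← conj_zpow, ← hk, ← zpow_mul, pow_succ']
  -- k^j = 1 modulo |E| means that t^j centralizes E, so that t^j ∈ E ∩ H = 1.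
  have hkt : ∀ j : ℕ, (k : ZMod (Nat.card E)) ^ j = 1 ↔ t ^ j = 1 := by
    intro j
    have h1 : (k : ZMod (Nat.card E)) ^ j = 1 ↔ s ^ (k ^ j) = s := by
      rw [← sub_eq_zero, ← mul_inv_eq_one (a := s ^ k ^ j), ← zpow_sub_one,
        ← orderOf_dvd_iff_zpow_eq_one, hos, ← ZMod.intCast_zmod_eq_zero_iff_dvd]
      push_cast; rfl
    rw [h1, ← hconj]
    refine ⟨fun h => ?_, fun h => by simp [h]⟩
    have hc : t ^ j ∈ E := hf (by
      rw [← hs', Subgroup.mem_centralizer_iff]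
      rintro x ⟨i, rfl⟩
      have h2 : Commute (t ^ j) s := by rwa [mul_inv_eq_iff_eq_mul] at h
      exact (h2.zpow_right i).eq.symm)
    exact Subgroup.disjoint_def.1 hEH.disjoint hc (pow_mem htH j)
  have hord : orderOf (k : ZMod (Nat.card E)) = Nat.card H := by
    rw [← hot]; exact orderOf_eq_orderOf_iff.2 hkt
  refine ⟨k, by rw [← hEH.card_mul_card, mul_comm], hcop, ?_, hord, ?_⟩
  · have hu : IsUnit (k : ZMod (Nat.card E)) :=
      IsUnit.of_pow_eq_one (n := Nat.card H) (by rw [hkt, ← hot, pow_orderOf_eq_one])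
        Nat.card_pos.ne'
    rw [ZMod.coe_int_isUnit_iff_isCoprime] at hu
    exact Int.isCoprime_iff_gcd_eq_one.1 hu.symm
  · obtain ⟨φ, hφs, hφt⟩ := MetacyclicGroup.exists_hom (d := Nat.card H) (e := Nat.card E) (k := k)
      (s := s) (t := t) (by rw [← hos, pow_orderOf_eq_one]) (by rw [← hot, pow_orderOf_eq_one])
      (by rw [hk]; group)
    refine ⟨(MulEquiv.ofBijective φ ⟨?_, ?_⟩).symm⟩
    · rw [injective_iff_map_eq_one]
      intro g hg
      obtain ⟨i, j, rfl⟩ := MetacyclicGroup.exists_eq_zpow_mul_zpow Nat.card_pos.ne' g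
      rw [map_mul, map_zpow, map_zpow, hφs, hφt] at hg
      have hsi : s ^ i = 1 := Subgroup.disjoint_def.1 hEH.disjoint (zpow_mem hsE i)
        (by rw [eq_inv_of_mul_eq_one_left hg]; exact inv_mem (zpow_mem htH j))
      have htj : t ^ j = 1 := by rwa [hsi, one_mul] at hg
      rw [← orderOf_dvd_iff_zpow_eq_one] at hsi htj
      rw [hos] at hsi
      rw [hot] at htj
      obtain ⟨i, rfl⟩ := hsi
      obtain ⟨j, rfl⟩ := htj
      simp [zpow_mul, MetacyclicGroup.sigma_pow, MetacyclicGroup.tau_pow]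
    · intro a
      have : a ∈ E ⊔ H := by rw [hEH.sup_eq_top]; trivial
      rw [Subgroup.mem_sup_of_normal_left] at this
      obtain ⟨x, hx, y, hy, rfl⟩ := this
      rw [← hs'] at hx
      rw [← ht'] at hy
      obtain ⟨i, rfl⟩ := hx
      obtain ⟨j, rfl⟩ := hy
      exact ⟨MetacyclicGroup.sigma _ _ k ^ i * MetacyclicGroup.tau _ _ k ^ j, by simp [hφs, hφt]⟩

/-- All Sylow subgroups are cyclic, so A' and A/A' are cyclic. Let E be the centralizer of A': it
contains A' centrally with cyclic quotient, so it is abelian, hence cyclic, and it is its own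
centralizer. A complement H meets A' trivially and so embeds in A/A'. -/
theorem exists_hasParameters {n : ℕ} (hn : Squarefree n) {A : Type*} [Group A]
    (hA : Nat.card A = n) : ∃ (d e : ℕ) (k : ℤ), HasParameters A n d e k := by
  subst hA
  have : Finite A := Nat.finite_of_card_ne_zero hn.ne_zero
  have : IsZGroup A := IsZGroup.of_squarefree hn
  have hAc : IsCyclic (commutator A) := IsZGroup.isCyclic_commutator A
  let E := Subgroup.centralizer (commutator A : Set A)
  have hE : commutator A ≤ E := by
    intro x hx
    rw [Subgroup.mem_centralizer_iff]
    intro y hy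
    have := hAc.isMulCommutative
    exact congrArg Subtype.val (mul_comm' (⟨y, hy⟩ : commutator A) ⟨x, hx⟩)
  have hEc : IsMulCommutative E := by
    refine MonoidHom.isMulCommutative_of_isCyclic_of_ker_le_center
      (Abelianization.of.comp E.subtype) fun x hx => ?_
    have hx' : (x : A) ∈ commutator A := by
      rw [← Abelianization.ker_of]; exact hx
    rw [Subgroup.mem_center_iff]
    intro y
    exact Subtype.ext ((Subgroup.mem_centralizer_iff.1 y.2) x hx').symm
  have hEcyc : IsCyclic E := by
    let _ : CommGroup E := { mul_comm := mul_comm' }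
    have : Group.IsNilpotent E := CommGroup.isNilpotent
    infer_instance
  have hcop : (Nat.card E).Coprime E.index := by
    have := hn
    rw [← E.card_mul_index] at this
    exact (Nat.squarefree_mul_iff.1 this).1
  obtain ⟨H, hH⟩ := Subgroup.exists_right_complement'_of_coprime hcop
  have hHc : IsCyclic H := by
    refine isCyclic_of_injective (Abelianization.of.comp H.subtype) ?_
    rw [injective_iff_map_eq_one]
    intro x hx
    have hx' : (x : A) ∈ commutator A := by
      rw [← Abelianization.ker_of]; exact hx
    exact Subtype.ext (Subgroup.disjoint_def.1 hH.disjoint (hE hx') x.2)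
  rw [hH.symm.index_eq_card] at hcop
  obtain ⟨k, hk⟩ := hasParameters_of_isComplement hH hcop.symm
    (Subgroup.centralizer_le hE)
  exact ⟨_, _, k, hk⟩

/-! ### Coordinates on metacyclic groups -/

/-- The affine maps `y ↦ lin * y + trans` of `ZMod p`. -/
@[ext]
structure ZModAffine (p : ℕ) where
  lin : (ZMod p)ˣ
  trans : ZMod p

namespace ZModAffine

variable {p : ℕ}

instance : Mul (ZModAffine p) := ⟨fun a b => ⟨a.lin * b.lin, a.trans + a.lin * b.trans⟩⟩
instance : One (ZModAffine p) := ⟨⟨1, 0⟩⟩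
instance : Inv (ZModAffine p) := ⟨fun a => ⟨a.lin⁻¹, -((a.lin⁻¹ : (ZMod p)ˣ) * a.trans)⟩⟩

@[simp] theorem mul_lin (a b : ZModAffine p) : (a * b).lin = a.lin * b.lin := rfl
@[simp] theorem mul_trans (a b : ZModAffine p) :
    (a * b).trans = a.trans + a.lin * b.trans := rfl
@[simp] theorem one_lin : (1 : ZModAffine p).lin = 1 := rfl
@[simp] theorem one_trans : (1 : ZModAffine p).trans = 0 := rfl
@[simp] theorem inv_lin (a : ZModAffine p) : (a⁻¹).lin = a.lin⁻¹ := rfl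
@[simp] theorem inv_trans (a : ZModAffine p) :
    (a⁻¹).trans = -((a.lin⁻¹ : (ZMod p)ˣ) * a.trans) := rfl

instance : Group (ZModAffine p) :=
  Group.ofLeftAxioms
    (fun a b c => ZModAffine.ext (by simp [mul_assoc]) (by simp; ring))
    (fun a => ZModAffine.ext (by simp) (by simp))
    (fun a => ZModAffine.ext (by simp) (by simp))

/-- The linear part. -/
def linHom : ZModAffine p →* (ZMod p)ˣ := MonoidHom.mk' lin mul_lin

theorem mk_one_pow (y : ZMod p) (m : ℕ) :
    (⟨1, y⟩ : ZModAffine p) ^ m = ⟨1, m * y⟩ := by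
  induction m with
  | zero => ext <;> simp
  | succ m ih => rw [pow_succ, ih]; ext <;> simp; ring

theorem mk_one_zpow (y : ZMod p) (m : ℤ) :
    (⟨1, y⟩ : ZModAffine p) ^ m = ⟨1, m * y⟩ := by
  cases m with
  | ofNat m => simp [mk_one_pow]
  | negSucc m => rw [zpow_negSucc, mk_one_pow]; ext <;> simp; ring

theorem mk_zero_pow (c : (ZMod p)ˣ) (m : ℕ) :
    (⟨c, 0⟩ : ZModAffine p) ^ m = ⟨c ^ m, 0⟩ := by
  induction m with
  | zero => ext <;> simp
  | succ m ih => rw [pow_succ, ih]; ext <;> simp [pow_succ]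

end ZModAffine

theorem Squarefree.intCast_dvd_of_forall_prime {m : ℕ} (hm : Squarefree m) {z : ℤ}
    (h : ∀ p : ℕ, p.Prime → p ∣ m → (p : ℤ) ∣ z) : (m : ℤ) ∣ z := by
  rw [Int.natCast_dvd, ← Nat.prod_primeFactors_of_squarefree hm]
  refine Finset.prod_primes_dvd _ (fun p hp => (Nat.prime_of_mem_primeFactors hp).prime)
    fun p hp => ?_
  exact Int.natCast_dvd.1 (h p (Nat.prime_of_mem_primeFactors hp) (Nat.dvd_of_mem_primeFactors hp))

/-- As e = zg is squarefree, each prime factor of e divides exactly one of z and g. -/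
theorem prime_dvd_paramG_iff {e : ℕ} (he : Squarefree e) (k : ℤ) {p : ℕ} (hp : p.Prime)
    (hpe : p ∣ e) : p ∣ paramG e k ↔ ¬ (p : ℤ) ∣ k - 1 := by
  have hz : paramZ e k ∣ e := by
    have := Int.gcd_dvd_right (k - 1) (e : ℤ)
    exact_mod_cast this
  have hmul : paramZ e k * paramG e k = e := Nat.mul_div_cancel' hz
  have hiff : p ∣ paramZ e k ↔ (p : ℤ) ∣ k - 1 := by
    rw [paramZ, ← Int.natCast_dvd_natCast, Int.dvd_coe_gcd_iff]
    exact and_iff_left (by exact_mod_cast hpe)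
  rw [← hiff]
  constructor
  · intro hg hz'
    have := he p (by rw [← hmul]; exact mul_dvd_mul hz' hg)
    exact hp.one_lt.ne' (Nat.isUnit_iff.1 this)
  · intro h
    rw [← hmul] at hpe
    exact ((hp.dvd_mul).1 hpe).resolve_left h

theorem paramG_dvd (e : ℕ) (k : ℤ) : paramG e k ∣ e := by
  have hz : paramZ e k ∣ e := by
    have := Int.gcd_dvd_right (k - 1) (e : ℤ)
    exact_mod_cast this
  exact Nat.div_dvd_of_dvd hz

theorem ZMod.units_eq_one_of_unitsMap {e : ℕ} (he : Squarefree e) {K : (ZMod e)ˣ}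
    (h : ∀ (p : ℕ) (_ : p.Prime) (hpe : p ∣ e), ZMod.unitsMap hpe K = 1) : K = 1 := by
  obtain ⟨z, hz⟩ := ZMod.intCast_surjective (K : ZMod e)
  ext
  rw [← hz, Units.val_one, ← sub_eq_zero, ← Int.cast_one, ← Int.cast_sub,
    ZMod.intCast_zmod_eq_zero_iff_dvd]
  refine he.intCast_dvd_of_forall_prime fun p hp hpe => ?_
  have := congrArg Units.val (h p hp hpe)
  rw [ZMod.unitsMap_val, ← hz, ZMod.cast_intCast hpe, Units.val_one] at this
  rw [← ZMod.intCast_zmod_eq_zero_iff_dvd]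
  push_cast
  rw [this, sub_self]

/-- G(d, e, k) acts affinely on each ℤ/p: for p ∣ d, σ is trivial and τ is translation by 1; for p ∣
e, σ is translation by 1 and τ is multiplication by k. Since k has order d, the characters and the
coordinates at p ∣ d both record exactly the exponent of τ modulo d. -/
theorem HasParameters.exists_coordSystem {A : Type*} [Group A] {n d e : ℕ} {k : ℤ}
    (h : HasParameters A n d e k) (hn : Squarefree n) :
    ∃ C : CoordSystem A n, (∀ p, p ∈ C.D ↔ (p : ℕ) ∣ d) ∧
      ∀ p, C.χ p ≠ 1 ↔ (p : ℕ) ∣ paramG e k := by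
  have hde := h.card_eq
  have hd : Squarefree d := hn.squarefree_of_dvd (hde ▸ dvd_mul_right d e)
  have he : Squarefree e := hn.squarefree_of_dvd (hde ▸ dvd_mul_left e d)
  obtain ⟨ι⟩ := h.iso
  obtain ⟨K, hK⟩ : IsUnit (k : ZMod e) := by
    rw [ZMod.coe_int_isUnit_iff_isCoprime]
    exact (Int.isCoprime_iff_gcd_eq_one.2 h.unit).symm
  have hKd : orderOf K = d := by rw [← orderOf_units, hK, h.order_eq]
  have hpe : ∀ p : n.primeFactors, ¬ (p : ℕ) ∣ d → (p : ℕ) ∣ e := fun p hp =>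
    ((Nat.prime_of_mem_primeFactors p.2).dvd_mul.1
      (hde ▸ Nat.dvd_of_mem_primeFactors p.2)).resolve_left hp
  have hpd : ∀ p : n.primeFactors, (p : ℕ) ∣ d → ¬ (p : ℕ) ∣ e := fun p hp hp' =>
    (Nat.prime_of_mem_primeFactors p.2).one_lt.ne'
      (Nat.dvd_one.1 (h.coprime ▸ Nat.dvd_gcd hp hp'))
  have hφ : ∀ p : n.primeFactors, ∃ φ : MetacyclicGroup d e k →* ZModAffine p,
      ((p : ℕ) ∣ d → φ (MetacyclicGroup.sigma d e k) = 1 ∧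
        φ (MetacyclicGroup.tau d e k) = ⟨1, 1⟩) ∧
      ∀ hp : ¬ (p : ℕ) ∣ d, φ (MetacyclicGroup.sigma d e k) = ⟨1, 1⟩ ∧
        φ (MetacyclicGroup.tau d e k) = ⟨ZMod.unitsMap (hpe p hp) K, 0⟩ := by
    intro p
    by_cases hp : (p : ℕ) ∣ d
    · obtain ⟨φ, h1, h2⟩ := MetacyclicGroup.exists_hom (d := d) (e := e) (k := k)
        (s := (1 : ZModAffine p)) (t := ⟨1, 1⟩) (one_pow e)
        (by rw [ZModAffine.mk_one_pow, (ZMod.natCast_eq_zero_iff d p).2 hp]; ext <;> simp)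
        (by simp)
      exact ⟨φ, fun _ => ⟨h1, h2⟩, fun hp' => absurd hp hp'⟩
    · obtain ⟨φ, h1, h2⟩ := MetacyclicGroup.exists_hom (d := d) (e := e) (k := k)
        (s := (⟨1, 1⟩ : ZModAffine p)) (t := ⟨ZMod.unitsMap (hpe p hp) K, 0⟩)
        (by rw [ZModAffine.mk_one_pow, (ZMod.natCast_eq_zero_iff e p).2 (hpe p hp)]; ext <;> simp)
        (by
          rw [ZModAffine.mk_zero_pow, ← map_pow, ← hKd, pow_orderOf_eq_one, map_one]; rfl)
        (by
          rw [ZModAffine.mk_one_zpow]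
          ext
          · simp
          · simp [ZMod.unitsMap_val, hK, ZMod.cast_intCast (hpe p hp)])
      exact ⟨φ, fun hp' => absurd hp' hp, fun _ => ⟨h1, h2⟩⟩
  choose φ hφd hφe using hφ
  have hform : ∀ g : MetacyclicGroup d e k, ∃ j : ℤ,
      (∀ p : n.primeFactors, (p : ℕ) ∣ d → φ p g = ⟨1, j⟩) ∧
      ∀ (p : n.primeFactors) (hp : ¬ (p : ℕ) ∣ d),
        (φ p g).lin = ZMod.unitsMap (hpe p hp) (K ^ j) := by
    intro g
    obtain ⟨i, j, rfl⟩ := MetacyclicGroup.exists_eq_zpow_mul_zpow hd.ne_zero g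
    refine ⟨j, fun p hp => ?_, fun p hp => ?_⟩
    · rw [map_mul, map_zpow, map_zpow, (hφd p hp).1, (hφd p hp).2, ZModAffine.mk_one_zpow]
      simp
    · change ZModAffine.linHom (φ p _) = _
      simp only [map_mul, map_zpow, (hφe p hp).1, (hφe p hp).2]
      change (1 : (ZMod p)ˣ) ^ i * (ZMod.unitsMap (hpe p hp) K) ^ j = _
      rw [one_zpow, one_mul]
  have hiff : ∀ m : ℤ, K ^ m = 1 ↔ (d : ℤ) ∣ m := fun m => by
    rw [← hKd, orderOf_dvd_iff_zpow_eq_one]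
  refine ⟨{ χ := fun p => (ZModAffine.linHom.comp (φ p)).comp ι.toMonoidHom
            x := fun p a => (φ p (ι a)).trans
            isCocycle := fun p a b => by beta_reduce; rw [map_mul, map_mul]; rfl
            nontrivial := fun p => ?_
            D := {p | (p : ℕ) ∣ d}
            char_of_mem := fun p hp => ?_
            eq_on_iff := fun a b => ?_ }, fun p => Iff.rfl, fun p => ?_⟩
  · by_cases hp : (p : ℕ) ∣ d
    · refine ⟨ι.symm (MetacyclicGroup.tau d e k), ?_, ?_⟩
      · change (φ p (ι (ι.symm _))).lin = 1
        rw [MulEquiv.apply_symm_apply, (hφd p hp).2]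
      · beta_reduce
        rw [MulEquiv.apply_symm_apply, (hφd p hp).2]
        exact one_ne_zero
    · refine ⟨ι.symm (MetacyclicGroup.sigma d e k), ?_, ?_⟩
      · change (φ p (ι (ι.symm _))).lin = 1
        rw [MulEquiv.apply_symm_apply, (hφe p hp).1]
      · beta_reduce
        rw [MulEquiv.apply_symm_apply, (hφe p hp).1]
        exact one_ne_zero
  · ext1 a
    obtain ⟨j, hj, -⟩ := hform (ι a)
    change (φ p (ι a)).lin = 1
    rw [hj p hp]
  · obtain ⟨j, hj, hj'⟩ := hform (ι a)
    obtain ⟨l, hl, hl'⟩ := hform (ι b)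
    have key : (d : ℤ) ∣ j - l ↔ K ^ j = K ^ l := by
      rw [← hiff, zpow_sub, mul_inv_eq_one]
    constructor
    · intro hab q
      change (φ q (ι a)).lin = (φ q (ι b)).lin
      by_cases hq : (q : ℕ) ∣ d
      · rw [hj q hq, hl q hq]
      rw [hj' q hq, hl' q hq, key.1]
      refine hd.intCast_dvd_of_forall_prime fun p hp hpd' => ?_
      have hpn : p ∈ n.primeFactors :=
        Nat.mem_primeFactors.2 ⟨hp, hpd'.trans (hde ▸ dvd_mul_right d e), hn.ne_zero⟩
      have := hab ⟨p, hpn⟩ hpd'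
      rw [hj ⟨p, hpn⟩ hpd', hl ⟨p, hpn⟩ hpd'] at this
      rw [← ZMod.intCast_zmod_eq_zero_iff_dvd, Int.cast_sub]
      exact sub_eq_zero.2 this
    · intro hab p hp
      have hdvd : (d : ℤ) ∣ j - l := by
        rw [← hiff]
        refine ZMod.units_eq_one_of_unitsMap he fun q hq hqe => ?_
        have hqn : q ∈ n.primeFactors :=
          Nat.mem_primeFactors.2 ⟨hq, hqe.trans (hde ▸ dvd_mul_left e d), hn.ne_zero⟩
        have hqd : ¬ q ∣ d := fun hqd => hpd ⟨q, hqn⟩ hqd hqe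
        have : (φ ⟨q, hqn⟩ (ι a)).lin = (φ ⟨q, hqn⟩ (ι b)).lin := hab ⟨q, hqn⟩
        rw [hj' ⟨q, hqn⟩ hqd, hl' ⟨q, hqn⟩ hqd] at this
        rw [zpow_sub, map_mul, map_inv, mul_inv_eq_one]
        exact this
      change (φ p (ι a)).trans = (φ p (ι b)).trans
      rw [hj p hp, hl p hp]
      have : ((p : ℕ) : ℤ) ∣ j - l := (Int.natCast_dvd_natCast.2 hp).trans hdvd
      rw [← ZMod.intCast_zmod_eq_zero_iff_dvd, Int.cast_sub] at this
      exact sub_eq_zero.1 this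
  · have hpp := Nat.prime_of_mem_primeFactors p.2
    by_cases hp : (p : ℕ) ∣ d
    · refine iff_of_false (fun hne => hne (MonoidHom.ext fun a => ?_))
        fun hg => hpd p hp (hg.trans (paramG_dvd e k))
      obtain ⟨j, hj, -⟩ := hform (ι a)
      change (φ p (ι a)).lin = 1
      rw [hj p hp]
    · rw [prime_dvd_paramG_iff he k hpp (hpe p hp), not_iff_not]
      have h1 : ZMod.unitsMap (hpe p hp) K = 1 ↔ ((p : ℕ) : ℤ) ∣ k - 1 := by
        rw [← ZMod.intCast_zmod_eq_zero_iff_dvd, Units.ext_iff, ZMod.unitsMap_val, hK,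
          ZMod.cast_intCast (hpe p hp), ← sub_eq_zero]
        push_cast; rfl
      rw [← h1]
      constructor
      · intro hχ
        have : (φ p (ι (ι.symm (MetacyclicGroup.tau d e k)))).lin = 1 :=
          DFunLike.congr_fun hχ (ι.symm (MetacyclicGroup.tau d e k))
        rwa [MulEquiv.apply_symm_apply, (hφe p hp).2] at this
      · intro hK1
        ext1 a
        obtain ⟨j, -, hj⟩ := hform (ι a)
        change (φ p (ι a)).lin = 1
        rw [hj p hp, map_zpow, hK1, one_zpow]

/-! ### Cyclic and dihedral groups -/

namespace CoordSystem

variable {G : Type*} [Group G] {n : ℕ} (C : CoordSystem G n)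

/-- Conjugation by a fixes a translation t but multiplies x t by χ a. -/
theorem char_eq_one_of_isCyclic [IsCyclic G] (p : n.primeFactors) : C.χ p = 1 := by
  obtain ⟨t, ht, hx⟩ := C.nontrivial p
  ext a
  have hcomm : a * t * a⁻¹ = t := by
    rw [IsCyclic.isMulCommutative.is_comm.comm a t, mul_inv_cancel_right]
  have := (C.isCocycle p).map_conj a ht
  rw [hcomm] at this
  rw [MonoidHom.one_apply, Units.val_one]
  exact mul_right_cancel₀ hx (by rw [one_mul, ← this])

theorem notMem_of_forall_char_eq_one (h : ∀ p, C.χ p = 1) (p : n.primeFactors) : p ∉ C.D := by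
  intro hp
  obtain ⟨t, -, hx⟩ := C.nontrivial p
  apply hx
  rw [(C.eq_on_iff t 1).2 (fun q => by simp [h q]) p hp, (C.isCocycle p).map_one]

theorem char_eq_one_of_eq_two {p : n.primeFactors} (hp : (p : ℕ) = 2) : C.χ p = 1 := by
  obtain ⟨p, hpn⟩ := p
  dsimp only at hp
  subst hp
  exact MonoidHom.ext fun a => (by decide : ∀ u : (ZMod 2)ˣ, u = 1) _

/-- With trivial character x is additive, so for odd p it kills the reflections, being involutions,
and hence the rotations, being products of two reflections. -/
theorem char_ne_one_of_mulEquiv_dihedralGroup {m : ℕ} (f : G ≃* DihedralGroup m)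
    {p : n.primeFactors} (hp : (p : ℕ) ≠ 2) : C.χ p ≠ 1 := by
  intro hχ
  have hadd : ∀ a b, C.x p (f.symm (a * b)) = C.x p (f.symm a) + C.x p (f.symm b) := fun a b => by
    rw [map_mul, C.isCocycle, hχ]; simp
  have h2 : (2 : ZMod p) ≠ 0 := by
    intro h
    have : (p : ℕ) ∣ 2 := (ZMod.natCast_eq_zero_iff 2 p).1 (by exact_mod_cast h)
    exact hp ((Nat.prime_dvd_prime_iff_eq (Nat.prime_of_mem_primeFactors p.2) Nat.prime_two).1 this)
  have hsr : ∀ i, C.x p (f.symm (DihedralGroup.sr i)) = 0 := fun i => by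
    have := hadd (DihedralGroup.sr i) (DihedralGroup.sr i)
    rw [DihedralGroup.sr_mul_self, map_one, (C.isCocycle p).map_one] at this
    exact (mul_eq_zero.1 (show 2 * C.x p (f.symm (DihedralGroup.sr i)) = 0 by
      linear_combination -this)).resolve_left h2
  have hr : ∀ i, C.x p (f.symm (DihedralGroup.r i)) = 0 := fun i => by
    have := hadd (DihedralGroup.sr 0) (DihedralGroup.sr i)
    rwa [DihedralGroup.sr_mul_sr, sub_zero, hsr, hsr, add_zero] at this
  obtain ⟨t, -, hx⟩ := C.nontrivial p
  apply hx
  rw [← f.symm_apply_apply t]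
  cases f t with
  | r i => exact hr i
  | sr i => exact hsr i

end CoordSystem

theorem numSkewBraces_eq_two_pow_cardDistinctFactors {M A : Type u} [Group M] [Group A] {n : ℕ}
    (CM : CoordSystem M n) (CA : CoordSystem A n) (hn : Squarefree n)
    (hM : Nat.card M = n) (hA : Nat.card A = n) (hD : ∀ p ∈ CA.D, CM.χ p = 1)
    (hDD : ∀ p ∈ CA.D, p ∈ CM.D → (p : ℕ) = 2) {g : ℕ} (hg : g ∣ n)
    (hχ : ∀ p, CA.χ p ≠ 1 ↔ (p : ℕ) ∣ g) :
    numSkewBraces M A = 2 ^ ArithmeticFunction.cardDistinctFactors g := by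
  have hg0 : g ≠ 0 := ne_zero_of_dvd_ne_zero hn.ne_zero hg
  rw [numSkewBraces_eq_two_pow CM CA hn hM hA hD hDD
    (Finset.univ.filter fun p : n.primeFactors => (p : ℕ) ∣ g) (fun p => by simp [hχ]),
    ArithmeticFunction.cardDistinctFactors_apply, ← List.card_toFinset, Nat.toFinset_factors]
  congr 1
  refine Finset.card_bij (fun p _ => (p : ℕ)) (fun p hp => ?_) (fun p _ q _ hpq => Subtype.ext hpq)
    (fun q hq => ?_)
  · exact Nat.mem_primeFactors.2
      ⟨Nat.prime_of_mem_primeFactors p.2, (Finset.mem_filter.1 hp).2, hg0⟩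
  · exact ⟨⟨q, Nat.primeFactors_mono hg hn.ne_zero hq⟩,
      Finset.mem_filter.2 ⟨Finset.mem_univ _, Nat.dvd_of_mem_primeFactors hq⟩, rfl⟩

theorem mainTheorem2 (n : ℕ) (hn : Squarefree n) (M A : Type u) [Group M] [Group A]
    (hM : Nat.card M = n) (hA : Nat.card A = n) :
    -- every group of order `n` is some `G(d, e, k)`, so that the parameters below exist
    (∃ (d e : ℕ) (k : ℤ), HasParameters A n d e k) ∧
    -- (i) `M` cyclic
    (IsCyclic M → ∀ (d e : ℕ) (k : ℤ), HasParameters A n d e k →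
      numSkewBraces M A = 2 ^ ArithmeticFunction.cardDistinctFactors (paramG e k)) ∧
    -- (ii) `A` cyclic
    (IsCyclic A → numSkewBraces M A = 1) ∧
    -- (iii) `M` dihedral of order `2 m`
    (∀ m : ℕ, Odd m → Squarefree m → Nonempty (M ≃* DihedralGroup m) →
      ∀ (d e : ℕ) (k : ℤ), HasParameters A n d e k →
        (d = 1 ∨ d = 2 →
          numSkewBraces M A = 2 ^ ArithmeticFunction.cardDistinctFactors (paramG e k)) ∧
        (2 < d → numSkewBraces M A = 0)) ∧
    -- (iv) `A` dihedral of order `2 m`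
    (∀ m : ℕ, Odd m → Squarefree m → Nonempty (A ≃* DihedralGroup m) →
      numSkewBraces M A = 2 ^ ArithmeticFunction.cardDistinctFactors m) := by
  obtain ⟨dM, eM, kM, hparM⟩ := exists_hasParameters hn hM
  obtain ⟨CM, -, -⟩ := hparM.exists_coordSystem hn
  have hparA := exists_hasParameters hn hA
  have hgn : ∀ {d e : ℕ} {k : ℤ}, HasParameters A n d e k → paramG e k ∣ n := fun {d e k} h =>
    (paramG_dvd e k).trans (h.card_eq ▸ dvd_mul_left e d)
  refine ⟨hparA, fun hcyc d e k h => ?_, fun hcyc => ?_, ?_, ?_⟩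
  · obtain ⟨CA, -, hχ⟩ := h.exists_coordSystem hn
    exact numSkewBraces_eq_two_pow_cardDistinctFactors CM CA hn hM hA
      (fun p _ => CM.char_eq_one_of_isCyclic p)
      (fun p _ hp => absurd hp (CM.notMem_of_forall_char_eq_one CM.char_eq_one_of_isCyclic p))
      (hgn h) hχ
  · obtain ⟨d, e, k, h⟩ := hparA
    obtain ⟨CA, -, -⟩ := h.exists_coordSystem hn
    have hD : ∀ p, p ∉ CA.D := CA.notMem_of_forall_char_eq_one CA.char_eq_one_of_isCyclic
    rw [numSkewBraces_eq_two_pow_cardDistinctFactors CM CA hn hM hA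
      (fun p hp => absurd hp (hD p)) (fun p hp => absurd hp (hD p)) (one_dvd n) fun p =>
        iff_of_false (not_not.2 (CA.char_eq_one_of_isCyclic p))
          fun h1 => (Nat.prime_of_mem_primeFactors p.2).ne_one (Nat.dvd_one.1 h1)]
    simp
  · rintro m - - ⟨f⟩ d e k h
    obtain ⟨CA, hD, hχ⟩ := h.exists_coordSystem hn
    refine ⟨fun hd => ?_, fun hd => ?_⟩
    · have h2 : ∀ p ∈ CA.D, (p : ℕ) = 2 := fun p hp => by
        have hpp := Nat.prime_of_mem_primeFactors p.2
        rw [hD] at hp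
        rcases hd with rfl | rfl
        · exact absurd (Nat.dvd_one.1 hp) hpp.ne_one
        · exact (Nat.prime_dvd_prime_iff_eq hpp Nat.prime_two).1 hp
      exact numSkewBraces_eq_two_pow_cardDistinctFactors CM CA hn hM hA
        (fun p hp => CM.char_eq_one_of_eq_two (h2 p hp)) (fun p hp _ => h2 p hp) (hgn h) hχ
    · have hdn : d ∣ n := h.card_eq ▸ dvd_mul_right d e
      -- A squarefree d > 2 has an odd prime factor, where M has a nontrivial character.
      obtain ⟨p, hp, hpd, hp2⟩ : ∃ p : ℕ, p.Prime ∧ p ∣ d ∧ p ≠ 2 := by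
        by_contra! hcon
        have : (d : ℤ) ∣ (2 : ℕ) :=
          (hn.squarefree_of_dvd hdn).intCast_dvd_of_forall_prime fun p hp hpd => by
            rw [hcon p hp hpd]
        exact absurd (Nat.le_of_dvd two_pos (Int.natCast_dvd_natCast.1 this)) (by omega)
      have hpn : p ∈ n.primeFactors := Nat.mem_primeFactors.2 ⟨hp, hpd.trans hdn, hn.ne_zero⟩
      exact numSkewBraces_eq_zero CM CA hn hM hA ((hD ⟨p, hpn⟩).2 hpd)
        (CM.char_ne_one_of_mulEquiv_dihedralGroup f hp2)
  · rintro m hm - ⟨f⟩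
    obtain ⟨d, e, k, h⟩ := hparA
    obtain ⟨CA, -, -⟩ := h.exists_coordSystem hn
    have hn2 : n = 2 * m := by rw [← hA, Nat.card_congr f.toEquiv, DihedralGroup.nat_card]
    -- Characters are trivial on `D`, but in a dihedral group they are nontrivial at every odd
    -- prime.
    have h2 : ∀ p ∈ CA.D, (p : ℕ) = 2 := fun p hp => by
      by_contra hp2
      exact CA.char_ne_one_of_mulEquiv_dihedralGroup f hp2 (CA.char_of_mem p hp)
    refine numSkewBraces_eq_two_pow_cardDistinctFactors CM CA hn hM hA
      (fun p hp => CM.char_eq_one_of_eq_two (h2 p hp)) (fun p hp _ => h2 p hp)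
      (hn2 ▸ dvd_mul_left m 2) fun p => ?_
    by_cases hp : (p : ℕ) = 2
    · refine iff_of_false (not_not.2 (CA.char_eq_one_of_eq_two hp)) ?_
      rw [hp]
      exact hm.not_two_dvd_nat
    · have hpp := Nat.prime_of_mem_primeFactors p.2
      refine iff_of_true (CA.char_ne_one_of_mulEquiv_dihedralGroup f hp) ?_
      refine ((hpp.dvd_mul).1 ((Nat.dvd_of_mem_primeFactors p.2).trans hn2.dvd)).resolve_left fun h' => ?_
      exact hp ((Nat.prime_dvd_prime_iff_eq hpp Nat.prime_two).1 h')
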